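/- **Setting.** Consider the planar impulsive system $$\dot x=f(x)+\varepsilon g(t,x,\varepsilon)\ (t\ne t_k),\qquad x(t_k+)-x(t_k-)=\varepsilon\, l_k(x(t_k-),\varepsilon)\ (k\in\mathbb Z),\qquad x\in\mathbb R^2,\ |\varepsilon|<\varepsilon_1, \tag{$*$}$$ where $f=(H_{x_2},-H_{x_1})$ with $H\in C^4(\mathbb R^2)$; $g$ is of class $C^3$ and $T_1$-periodic in $t$; $\cdots<t_{-1}<t_0<t_1<\cdots$ with $t_k\to\pm\infty$ as $k\to\pm\infty$; there are $T_2>0$ and an integer $n\ge1$ with $t_{k+n}-t_k=T_2$ and $l_{k+n}=l_k$ for all $k$; $T_2/T_1=p/s$ with $p,s\ge1$ coprime; each $l_k$ is $C^3$ in $x$ and continuous in $(x,\varepsilon)$. Put $T=pT_1=sT_2$. Solutions are defined on $\mathbb R$ and are continuous from the left at the $t_k$. A solution with $x(t+mT\pm)=x(t\pm)$ for all $t$ is called harmonic if $m=1$ and subharmonic of order $m$ if $m>1$. Let $V$ be an open interval such that for each $h\in V$ the level set $\{H=h\}$ contains a closed orbit $L_h$ of $\dot x=f(x)$, with least period $T(h)>0$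 and time parametrization $x=q(t,h)$, where $q$ is of class $C^3$ on $\mathbb R\times V$. Put $\Omega(h)=2\pi/T(h)$, $G(\theta,h)=q(\theta/\Omega(h),h)$, and let $\alpha(\theta,h)$ be the row vector with $\alpha D_hG=0$, $\alpha D_\theta G=1$; explicitly, if $D_hG=(g_1,g_2)^\top$, then $\alpha=[(-g_2,g_1)D_\theta G]^{-1}(-g_2,g_1)$. Suppose that the family is isochronous and resonant: $T(h)=T_0$ for all $h\in V$ and $T_0/T=m/K$ with coprime integers $m,K\ge1$. Define, for $\tau\in\mathbb R$ and $r\in V$, $$M(\tau,r)=\int_{\tau}^{\tau+mT}DH(q(t-\tau,r))\,g(t,q(t-\tau,r),0)\,dt+\sum_{k=1}^{msn}DH(q(t_k-\tau,r))\,l_k(q(t_k-\tau,r),0),$$ $$N(\tau,r)=\int_{\tau}^{\tau+mT}\alpha\big(\tfrac{2\pi}{T_0}(t-\tau),r\big)\,g(t,q(t-\tau,r),0)\,dt+\sum_{k=1}^{msn}\alpha\big(\tfrac{2\pi}{T_0}(t_k-\tau),r\big)\,l_k(q(t_k-\tau,r),0).$$ **Theorem.** (1) For every compact set $C\subset V$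 there is $\varepsilon_0>0$ such that, if for some $\varepsilon$ with $0<|\varepsilon|<\varepsilon_0$ the system $(*)$ has a harmonic ($m=1$) or subharmonic of order $m$ ($m>1$) solution that at some time takes a value on $\bigcup_{h\in C}L_h$, then there are $t_0^*\in[0,T_0]$ and $h_0\in C$ with $$M(t_0^*,h_0)=0,\qquad N(t_0^*,h_0)=0.$$ (2) Suppose that $t_0^*\in[0,T_0]$ and $h_0\in V$ satisfy $M(t_0^*,h_0)=N(t_0^*,h_0)=0$ and that $$J=\begin{vmatrix}\partial M/\partial \tau&\partial M/\partial r\\ \partial N/\partial \tau&\partial N/\partial r\end{vmatrix}_{(t_0^*,h_0)}\ne0 .$$ Then there are $\varepsilon_0>0$ and, for every $\varepsilon$ with $0<|\varepsilon|<\varepsilon_0$, a harmonic ($m=1$) or subharmonic of order $m$ ($m>1$) solution $x_\varepsilon$ of $(*)$ such that $\lim_{\varepsilon\to0}x_\varepsilon(t)=q(t-t_0^*,h_0)$ for every $t\in\mathbb R$. -/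

import Mathlib

open Set Filter Topology

noncomputable section

/-- The Hamiltonian vector field `f = (H_{x₂}, -H_{x₁})` on the plane. -/
def hamiltonianField (H : ℝ × ℝ → ℝ) (x : ℝ × ℝ) : ℝ × ℝ :=
  (fderiv ℝ H x (0, 1), -fderiv ℝ H x (1, 0))

/-- The data of the periodic impulsive perturbation
`x' = f(x) + ε g(t,x,ε)` for `t ≠ t_k`, `x(t_k+) - x(t_k-) = ε l_k(x(t_k-), ε)`
of the planar Hamiltonian system `x' = f(x)`, with the regularity and periodicity conditions
imposed on it.  The parameter `ε` ranges over `|ε| < ε₁`. -/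
structure ImpulsiveHamiltonianSystem where
  /-- the Hamiltonian -/
  H : ℝ × ℝ → ℝ
  /-- the perturbation `g(t,x,ε)` -/
  g : ℝ → ℝ × ℝ → ℝ → ℝ × ℝ
  /-- the impulsive moments -/
  t : ℤ → ℝ
  /-- the impulses `l_k(x,ε)` -/
  l : ℤ → ℝ × ℝ → ℝ → ℝ × ℝ
  /-- bound for the parameter `ε` -/
  ε₁ : ℝ
  /-- period of `g` in `t` -/
  T₁ : ℝ
  /-- period of the sequence of impulses -/
  T₂ : ℝ
  /-- number of impulses in one period `T₂` -/
  nImp : ℕ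
  /-- numerator of `T₂ / T₁` -/
  p : ℕ
  /-- denominator of `T₂ / T₁` -/
  s : ℕ
  ε₁_pos : 0 < ε₁
  H_smooth : ContDiff ℝ 4 H
  g_smooth : ContDiffOn ℝ 3 (fun z : ℝ × (ℝ × ℝ) × ℝ => g z.1 z.2.1 z.2.2)
    (univ ×ˢ (univ ×ˢ Ioo (-ε₁) ε₁))
  T₁_pos : 0 < T₁
  g_periodic : ∀ τ x ε, ε ∈ Ioo (-ε₁) ε₁ → g (τ + T₁) x ε = g τ x ε
  t_strictMono : StrictMono t
  t_atTop : Tendsto t atTop atTop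
  t_atBot : Tendsto t atBot atBot
  T₂_pos : 0 < T₂
  nImp_pos : 1 ≤ nImp
  t_periodic : ∀ k, t (k + nImp) - t k = T₂
  l_periodic : ∀ k x ε, ε ∈ Ioo (-ε₁) ε₁ → l (k + nImp) x ε = l k x ε
  p_pos : 1 ≤ p
  s_pos : 1 ≤ s
  coprime : Nat.Coprime p s
  ratio : T₂ / T₁ = (p : ℝ) / s
  l_smooth : ∀ k, ∀ ε ∈ Ioo (-ε₁) ε₁, ContDiff ℝ 3 (fun x => l k x ε)
  l_continuous : ∀ k, ContinuousOn (fun z : (ℝ × ℝ) × ℝ => l k z.1 z.2)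
    (univ ×ˢ Ioo (-ε₁) ε₁)

namespace ImpulsiveHamiltonianSystem

/-- The period `T = p T₁ = s T₂` of the impulsive system. -/
def T (S : ImpulsiveHamiltonianSystem) : ℝ := S.p * S.T₁

theorem T_eq (S : ImpulsiveHamiltonianSystem) : S.T = S.s * S.T₂ := by
  have h := S.ratio
  have h1 := S.T₁_pos.ne'
  have h2 : (S.s : ℝ) ≠ 0 := by exact_mod_cast (Nat.one_le_iff_ne_zero.mp S.s_pos)
  unfold T
  field_simp at h
  linarith

/-- `x : ℝ → ℝ²` is a solution (on the whole line) of the impulsive system with parameter `ε`: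
it satisfies the differential equation off the impulsive moments, is continuous from the left
at each `t_k` (so that `x(t_k-) = x(t_k)`), and has there the right limit
`x(t_k+) = x(t_k-) + ε l_k(x(t_k-), ε)`. -/
structure IsSolution (S : ImpulsiveHamiltonianSystem) (ε : ℝ) (x : ℝ → ℝ × ℝ) : Prop where
  ode : ∀ τ, τ ∉ range S.t →
    HasDerivAt x (hamiltonianField S.H (x τ) + ε • S.g τ (x τ) ε) τ
  left_cont : ∀ k, ContinuousWithinAt x (Iic (S.t k)) (S.t k)
  jump : ∀ k, Tendsto x (𝓝[>] (S.t k)) (𝓝 (x (S.t k) + ε • S.l k (x (S.t k)) ε))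

/-- `x` is a harmonic (`m = 1`) or subharmonic of order `m` (`m > 1`) solution: a solution with
`x(τ + mT ±) = x(τ ±)` for all `τ`.  As solutions are continuous from the left, this is ordinary
periodicity of the function `x`. -/
def IsSubharmonic (S : ImpulsiveHamiltonianSystem) (m : ℕ) (ε : ℝ) (x : ℝ → ℝ × ℝ) : Prop :=
  S.IsSolution ε x ∧ Function.Periodic x (m * S.T)

end ImpulsiveHamiltonianSystem

/-- A family of closed orbits `L_h ⊆ {H = h}`, `h ∈ V`, of `x' = f(x)`, with `V` an open interval,
in its time parametrization `q(·,h)`, where `per h` is the (least) period of `L_h`. -/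
structure PeriodicFamily (H : ℝ × ℝ → ℝ) where
  /-- the interval of energies -/
  V : Set ℝ
  /-- the time parametrization -/
  q : ℝ → ℝ → ℝ × ℝ
  /-- the period function -/
  per : ℝ → ℝ
  V_open : IsOpen V
  V_interval : V.OrdConnected
  q_smooth : ContDiffOn ℝ 3 (fun z : ℝ × ℝ => q z.1 z.2) (univ ×ˢ V)
  q_level : ∀ h ∈ V, ∀ τ, H (q τ h) = h
  q_ode : ∀ h ∈ V, ∀ τ, HasDerivAt (fun σ => q σ h) (hamiltonianField H (q τ h)) τ
  per_pos : ∀ h ∈ V, 0 < per h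
  q_periodic : ∀ h ∈ V, Function.Periodic (fun τ => q τ h) (per h)
  per_least : ∀ h ∈ V, ∀ c, 0 < c → Function.Periodic (fun τ => q τ h) c → per h ≤ c

/-- Product of a row vector with a column vector. -/
def rowMul (a v : ℝ × ℝ) : ℝ := a.1 * v.1 + a.2 * v.2

namespace PeriodicFamily

variable {H : ℝ × ℝ → ℝ}

/-- The frequency `Ω(h) = 2π / T(h)`. -/
def Ω (A : PeriodicFamily H) (h : ℝ) : ℝ := 2 * Real.pi / A.per h

/-- `G(θ,h) = q(θ / Ω(h), h)`. -/
def G (A : PeriodicFamily H) (θ h : ℝ) : ℝ × ℝ := A.q (θ / A.Ω h) h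

/-- The partial derivative `D_h G`. -/
def DhG (A : PeriodicFamily H) (θ h : ℝ) : ℝ × ℝ := deriv (fun h' => A.G θ h') h

/-- The partial derivative `D_θ G`. -/
def DθG (A : PeriodicFamily H) (θ h : ℝ) : ℝ × ℝ := deriv (fun θ' => A.G θ' h) θ

/-- The row vector `α(θ,h)` with `α D_h G = 0` and `α D_θ G = 1`: with `D_h G = (g₁, g₂)ᵀ`,
`α = [(-g₂, g₁) D_θ G]⁻¹ (-g₂, g₁)`. -/
def α (A : PeriodicFamily H) (θ h : ℝ) : ℝ × ℝ :=
  (rowMul (-(A.DhG θ h).2, (A.DhG θ h).1) (A.DθG θ h))⁻¹ • (-(A.DhG θ h).2, (A.DhG θ h).1)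

theorem rowMul_α_DhG (A : PeriodicFamily H) (θ h : ℝ) :
    rowMul (A.α θ h) (A.DhG θ h) = 0 := by
  simp only [α, rowMul, Prod.smul_mk, smul_eq_mul]
  ring

theorem rowMul_α_DθG (A : PeriodicFamily H) (hH : Differentiable ℝ H) {θ h : ℝ} (hh : h ∈ A.V)
    (hd : DifferentiableAt ℝ (fun h' => A.G θ h') h) :
    rowMul (A.α θ h) (A.DθG θ h) = 1 := by
  have hper := A.per_pos h hh
  have hΩ : 0 < A.Ω h := by unfold Ω; positivity
  have hθ : A.DθG θ h = (A.Ω h)⁻¹ • hamiltonianField H (A.G θ h) := by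
    have h1 := A.q_ode h hh (θ / A.Ω h)
    have h2 : HasDerivAt (fun θ' : ℝ => θ' / A.Ω h) (A.Ω h)⁻¹ θ := by
      simpa using (hasDerivAt_id θ).div_const (A.Ω h)
    exact (h1.scomp θ h2).deriv
  have hD : fderiv ℝ H (A.G θ h) (A.DhG θ h) = 1 := by
    have h1 := ((hH (A.G θ h)).hasFDerivAt).comp_hasDerivAt h hd.hasDerivAt
    have h2 : (H ∘ fun h' => A.G θ h') =ᶠ[𝓝 h] id := by
      filter_upwards [A.V_open.mem_nhds hh] with x hx
      exact A.q_level x hx _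
    exact (h1.congr_of_eventuallyEq h2.symm).unique (hasDerivAt_id h)
  have hlin : fderiv ℝ H (A.G θ h) (A.DhG θ h)
      = (A.DhG θ h).1 * fderiv ℝ H (A.G θ h) (1, 0)
        + (A.DhG θ h).2 * fderiv ℝ H (A.G θ h) (0, 1) := by
    rw [← smul_eq_mul, ← smul_eq_mul, ← map_smul, ← map_smul, ← map_add]
    simp
  have hdet : rowMul (-(A.DhG θ h).2, (A.DhG θ h).1) (A.DθG θ h) = -(A.Ω h)⁻¹ := by
    rw [hθ]
    simp only [rowMul, hamiltonianField, Prod.smul_mk, smul_eq_mul]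
    linear_combination (-(A.Ω h)⁻¹) * (hD.symm.trans hlin).symm
  have hne : rowMul (-(A.DhG θ h).2, (A.DhG θ h).1) (A.DθG θ h) ≠ 0 := by
    rw [hdet]; exact neg_ne_zero.mpr (inv_ne_zero hΩ.ne')
  have : rowMul (A.α θ h) (A.DθG θ h)
      = (rowMul (-(A.DhG θ h).2, (A.DhG θ h).1) (A.DθG θ h))⁻¹
        * rowMul (-(A.DhG θ h).2, (A.DhG θ h).1) (A.DθG θ h) := by
    simp only [α, rowMul, Prod.smul_mk, smul_eq_mul]
    ring
  rw [this, inv_mul_cancel₀ hne]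

end PeriodicFamily

/-- The Melnikov function `M(t̄₀,r)` of order `m`. -/
def melnikovM (S : ImpulsiveHamiltonianSystem) (A : PeriodicFamily S.H) (m : ℕ) (τ r : ℝ) : ℝ :=
  (∫ σ in τ..(τ + m * S.T), fderiv ℝ S.H (A.q (σ - τ) r) (S.g σ (A.q (σ - τ) r) 0))
    + ∑ k ∈ Finset.Icc (1 : ℤ) (m * S.s * S.nImp),
        fderiv ℝ S.H (A.q (S.t k - τ) r) (S.l k (A.q (S.t k - τ) r) 0)

/-- The angular Melnikov function `N(t̄₀,r)` of order `m` of an isochronous family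
(where `Ω' = 0`). -/
def melnikovN (S : ImpulsiveHamiltonianSystem) (A : PeriodicFamily S.H) (m : ℕ) (τ r : ℝ) : ℝ :=
  (∫ σ in τ..(τ + m * S.T),
      rowMul (A.α (A.Ω r * (σ - τ)) r) (S.g σ (A.q (σ - τ) r) 0))
    + ∑ k ∈ Finset.Icc (1 : ℤ) (m * S.s * S.nImp),
        rowMul (A.α (A.Ω r * (S.t k - τ)) r) (S.l k (A.q (S.t k - τ) r) 0)

end

/-!
Near the annulus filled by the closed orbits, the planar system is written in time–energy
coordinates `y = (u, r)` moving with the unperturbed flow, `x(t) = q(t + u, r)`. Since the energy of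
`q(u, r)` is `r`, the derivative of `q` has determinant one, and its inverse is explicit
(`PeriodicFamily.slow`): its second row is `DH`, its first row is `α` divided by the frequency. In
these coordinates an isochronous unperturbed flow is at rest, the perturbed equation reads
`y' = ε F(t, y, ε)`, and the impulses move `y` by `O(ε)`. Because `mT` is a multiple of the common
period `T₀`, solutions with period `mT` near the annulus are fixed points of the return map of `y`
over the `m s n` impulses in a period. The displacement of this return map is `ε D(y) + o(ε)`,
locally uniformly (`exists_step`, `isNearIdentity_iterStep`), and for `y = (-τ, r)` the components
of `D` are `N(τ, r)` divided by the frequency and `M(τ, r)` (`sum_stepDisplacement`).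

If a periodic solution meets the closed orbits with energies in `C` for arbitrarily small `ε`, then
`D` vanishes somewhere on the compact set `[-T₀, 0] × C`; otherwise neighbourhoods free of
periodic solutions would cover it (`exists_melnikov_zero_of_subharmonic`).

Conversely, let `D` have a nondegenerate zero. The impulses are merely continuous in `(x, ε)`, their
`x`-derivatives need not depend continuously on `ε`, and so the implicit function theorem does not
apply to the return map. A degree argument replaces it: a planar continuous map that is uniformly
close to an invertible linear map on a disk has a zero there, for otherwise it would have a
continuous logarithm on the disk (`exists_zero_of_norm_sub_self_lt`, `exists_zeros_tendsto`). The
arcs of the resulting fixed point are glued to a periodic solution (`isSubharmonic_of_arcs`,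
`exists_subharmonic_of_zeros`).
-/

noncomputable section

open PeriodicFamily

/-! ### Zeros of perturbed planar maps -/

/-- If `F` has no zero in the disk, `F` composed with polar coordinates has a continuous logarithm,
which is constant on the segment `s = 0`, hence `2π`-periodic in the angle; on the boundary circle,
however, `F z / z` stays near `1`, so the logarithm gains `2πi` in one turn. -/
theorem exists_zero_of_norm_sub_self_lt {F : ℂ → ℂ} {δ : ℝ} (hδ : 0 < δ)
    (hF : ContinuousOn F (Metric.closedBall 0 δ)) (h : ∀ z, ‖z‖ = δ → ‖F z - z‖ < δ) :
    ∃ z ∈ Metric.closedBall (0 : ℂ) δ, F z = 0 := by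
  by_contra! hne
  -- Polar coordinates on the disk, the radius being clamped so that they are defined on the plane.
  let c : ℝ × ℝ → ℂ := fun p =>
    ((max 0 (min 1 p.1) * δ : ℝ) : ℂ) * Complex.exp (p.2 * Complex.I)
  have hcn : ∀ p, ‖c p‖ = max 0 (min 1 p.1) * δ := fun p => by
    have : 0 ≤ max 0 (min 1 p.1) * δ := by positivity
    simp only [c]
    rw [norm_mul, Complex.norm_exp_ofReal_mul_I, mul_one, Complex.norm_real,
      Real.norm_eq_abs, abs_of_nonneg this]
  have hcmem : ∀ p, c p ∈ Metric.closedBall (0 : ℂ) δ := fun p => by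
    rw [mem_closedBall_zero_iff, hcn]
    have : max 0 (min 1 p.1) ≤ 1 := max_le zero_le_one (min_le_left _ _)
    nlinarith
  have hcc : Continuous c := by fun_prop
  let g : C(ℝ × ℝ, ℂ) := ⟨fun p => F (c p), hF.comp_continuous hcc hcmem⟩
  have hg0 : ∀ p, g p ≠ 0 := fun p => hne _ (hcmem p)
  obtain ⟨L, ⟨-, hL⟩, -⟩ := Complex.isCoveringMapOn_exp.existsUnique_continuousMap_lifts g
    (a₀ := (0, 0)) (Complex.exp_log (hg0 _)) (fun p => hg0 p)
  have hL' : ∀ p, Complex.exp (L p) = F (c p) := fun p => congrFun hL p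
  have uniq : ∀ {a : ℝ × ℝ → ℂ} {b : ℝ × ℝ → ℂ}, Continuous a → Continuous b →
      (∀ p, Complex.exp (a p) = Complex.exp (b p)) → a (0, 0) = b (0, 0) → ∀ p, a p = b p := by
    intro a b ha hb hab h0 p
    refine congrFun (Complex.isCoveringMap_exp.eq_of_comp_eq ha hb ?_ (0, 0) h0) p
    funext q
    exact Subtype.ext (hab q)
  have hconst : ∀ θ : ℝ, L (0, θ) = L (0, 0) := fun θ =>
    uniq (a := fun p => L (0, p.2)) (b := fun _ => L (0, 0)) (by fun_prop) (by fun_prop)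
      (fun p => by simp [hL', c]) rfl (0, θ)
  have hper : ∀ p : ℝ × ℝ, L (p.1, p.2 + 2 * Real.pi) = L p :=
    uniq (a := fun p => L (p.1, p.2 + 2 * Real.pi)) (b := L) (by fun_prop) (by fun_prop)
      (fun p => by
        have : c (p.1, p.2 + 2 * Real.pi) = c p := by
          simp only [c]
          congr 1
          push_cast
          rw [add_mul, Complex.exp_add, Complex.exp_two_pi_mul_I, mul_one]
        rw [hL', hL', this])
      (by simp only; rw [hconst])
  have hb : ∀ θ : ℝ, ‖c (1, θ)‖ = δ := fun θ => by rw [hcn]; norm_num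
  have hb0 : ∀ θ : ℝ, c (1, θ) ≠ 0 := fun θ h0 => by
    have := hb θ
    rw [h0, norm_zero] at this
    exact hδ.ne this
  have hslit : ∀ θ : ℝ, F (c (1, θ)) / c (1, θ) ∈ Complex.slitPlane := fun θ => by
    have h1 : ‖F (c (1, θ)) / c (1, θ) - 1‖ < 1 := by
      rw [div_sub_one (hb0 θ), norm_div, hb, div_lt_one hδ]
      exact h _ (hb θ)
    simpa using Complex.mem_slitPlane_of_norm_lt_one h1
  have hFc : Continuous fun θ : ℝ => F (c (1, θ)) :=
    hF.comp_continuous (by fun_prop) fun _ => hcmem _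
  have hlogc : Continuous fun θ : ℝ => Complex.log (F (c (1, θ)) / c (1, θ)) :=
    (hFc.div (by fun_prop) hb0).clog hslit
  have hturn := uniq
    (a := fun p => L (1, p.2) - L (1, 0))
    (b := fun p => p.2 * Complex.I + Complex.log (F (c (1, p.2)) / c (1, p.2))
      - Complex.log (F (c (1, 0)) / c (1, 0)))
    (by fun_prop)
    (((by fun_prop : Continuous fun p : ℝ × ℝ => (p.2 : ℂ) * Complex.I).add
      (hlogc.comp continuous_snd)).sub continuous_const)
    (fun p => by
      rw [Complex.exp_sub, Complex.exp_sub, Complex.exp_add, hL', hL',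
        Complex.exp_log (Complex.slitPlane_ne_zero (hslit _)),
        Complex.exp_log (Complex.slitPlane_ne_zero (hslit _))]
      have h1 := hb0 p.2
      have h2 := hb0 0
      have h3 := hne _ (hcmem (1, 0))
      have h4 : c (1, p.2) = c (1, 0) * Complex.exp (p.2 * Complex.I) := by simp [c]
      field_simp
      rw [h4]
      ring)
    (by simp) (0, 2 * Real.pi)
  have h5 : c (1, 2 * Real.pi) = c (1, 0) := by simp [c]
  have h6 := hper (1, 0)
  simp only [zero_add] at h6
  simp only [h6, h5, sub_self, add_sub_cancel_right] at hturn
  have := hturn.symm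
  simp [Real.pi_ne_zero] at this

/-- A nondegenerate zero of `D`, the derivative there being the identity, persists under
continuous maps that are uniformly close to `D`. -/
theorem eventually_exists_zero_complex {E : ℂ → ℝ → ℂ} {D : ℂ → ℂ} {l : Filter ℝ}
    (hD : HasFDerivAt (𝕜 := ℝ) D (ContinuousLinearMap.id ℝ ℂ) 0) (hD0 : D 0 = 0)
    (hDc : ∀ᶠ z in 𝓝 0, ContinuousAt D z)
    (hEc : ∀ᶠ p in 𝓝 (0 : ℂ) ×ˢ l, ContinuousAt (fun z => E z p.2) p.1)
    (hED : ∀ᶠ z in 𝓝 0, Tendsto (fun p : ℂ × ℝ => E p.1 p.2) (𝓝 z ×ˢ l) (𝓝 (D z)))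
    {η : ℝ} (hη : 0 < η) :
    ∀ᶠ ε in l, ∃ z ∈ Metric.closedBall (0 : ℂ) η, E z ε = 0 := by
  obtain ⟨P, hP, Q, hQ, hPQ⟩ := eventually_prod_iff.1 hEc
  -- On a small circle, `D z - z` and `E z ε - D z` are each at most half of the radius.
  have hlin := hD.isLittleO.bound (show (0 : ℝ) < 1 / 2 by norm_num)
  simp only [hD0, sub_zero, ContinuousLinearMap.coe_id', id_eq] at hlin
  obtain ⟨r, hr, hball⟩ := Metric.nhds_basis_closedBall.eventually_iff.1
    (hlin.and (hDc.and (hED.and hP)))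
  set δ := min r η with hδ
  have hδ0 : 0 < δ := lt_min hr hη
  have hsub : Metric.closedBall (0 : ℂ) δ ⊆ Metric.closedBall 0 r :=
    Metric.closedBall_subset_closedBall (min_le_left _ _)
  have hunif : ∀ᶠ p in 𝓝ˢ (Metric.closedBall (0 : ℂ) δ) ×ˢ l, ‖E p.1 p.2 - D p.1‖ < δ / 2 := by
    refine (isCompact_closedBall (0 : ℂ) δ).mem_nhdsSet_prod_of_forall fun z hz => ?_
    obtain ⟨-, h2, h3, -⟩ := hball (hsub hz)
    have h4 : Tendsto (fun p : ℂ × ℝ => E p.1 p.2 - D p.1) (𝓝 z ×ˢ l) (𝓝 (D z - D z)) :=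
      h3.sub (h2.tendsto.comp tendsto_fst)
    rw [sub_self] at h4
    have := (Metric.tendsto_nhds.1 h4) (δ / 2) (by positivity)
    simp only [dist_zero_right] at this
    exact this
  obtain ⟨P', hP', Q', hQ', hPQ'⟩ := eventually_prod_iff.1 hunif
  have hP'' : ∀ z ∈ Metric.closedBall (0 : ℂ) δ, P' z := fun z hz => hP'.self_of_nhdsSet z hz
  filter_upwards [hQ, hQ'] with ε h1 h2
  obtain ⟨z, hz, hz0⟩ := exists_zero_of_norm_sub_self_lt (F := fun z => E z ε) hδ0
    (fun z hz => (hPQ (hball (hsub hz)).2.2.2 h1).continuousWithinAt)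
    (fun z hz => by
      have hzm : z ∈ Metric.closedBall (0 : ℂ) δ := by simp [hz]
      have h3 := hPQ' (hP'' z hzm) h2
      have h4 := (hball (hsub hzm)).1
      calc ‖E z ε - z‖ = ‖(E z ε - D z) + (D z - z)‖ := by congr 1; ring
        _ ≤ ‖E z ε - D z‖ + ‖D z - z‖ := norm_add_le _ _
        _ < δ / 2 + 1 / 2 * ‖z‖ := by exact add_lt_add_of_lt_of_le h3 h4
        _ = δ := by rw [hz]; ring)
  exact ⟨z, Metric.closedBall_subset_closedBall (min_le_right _ _) hz, hz0⟩

/-- A nondegenerate zero `y₀` of the planar map `D` is the limit of zeros of the maps `E · ε`,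
when these are continuous and converge locally uniformly to `D`. No derivative of `E` is involved,
so the zeros need not be unique. -/
theorem exists_zeros_tendsto {E : ℝ × ℝ → ℝ → ℝ × ℝ} {D : ℝ × ℝ → ℝ × ℝ} {y₀ : ℝ × ℝ}
    {B : (ℝ × ℝ) ≃L[ℝ] (ℝ × ℝ)} (hD : HasFDerivAt D (B : ℝ × ℝ →L[ℝ] ℝ × ℝ) y₀) (hD0 : D y₀ = 0)
    (hDc : ∀ᶠ y in 𝓝 y₀, ContinuousAt D y)
    (hEc : ∀ᶠ p in 𝓝 y₀ ×ˢ 𝓝[≠] (0 : ℝ), ContinuousAt (fun y => E y p.2) p.1)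
    (hED : ∀ᶠ y in 𝓝 y₀,
      Tendsto (fun p : (ℝ × ℝ) × ℝ => E p.1 p.2) (𝓝 y ×ˢ 𝓝[≠] 0) (𝓝 (D y))) :
    ∃ Y : ℝ → ℝ × ℝ, (∀ᶠ ε in 𝓝[≠] 0, E (Y ε) ε = 0) ∧ Tendsto Y (𝓝[≠] 0) (𝓝 y₀) := by
  let φ : ℂ ≃L[ℝ] ℝ × ℝ := Complex.equivRealProdCLM
  let ψ : ℂ → ℝ × ℝ := fun z => y₀ + φ z
  let χ : (ℝ × ℝ) ≃L[ℝ] ℂ := B.symm.trans φ.symm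
  have hψ0 : ψ 0 = y₀ := by simp [ψ]
  have hψc : Continuous ψ := by fun_prop
  have hψ : Tendsto ψ (𝓝 0) (𝓝 y₀) := by simpa [hψ0] using hψc.tendsto 0
  have hψp : ∀ z, Tendsto (fun p : ℂ × ℝ => (ψ p.1, p.2)) (𝓝 z ×ˢ 𝓝[≠] (0 : ℝ))
      (𝓝 (ψ z) ×ˢ 𝓝[≠] 0) := fun z =>
    ((hψc.tendsto z).comp tendsto_fst).prodMk tendsto_snd
  have hψd : HasFDerivAt ψ (φ : ℂ →L[ℝ] ℝ × ℝ) 0 := (φ.hasFDerivAt (x := 0)).const_add y₀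
  have key : ∀ η > 0, ∀ᶠ ε in 𝓝[≠] (0 : ℝ),
      ∃ z ∈ Metric.closedBall (0 : ℂ) η, χ (E (ψ z) ε) = 0 := by
    intro η hη
    refine eventually_exists_zero_complex (E := fun z ε => χ (E (ψ z) ε))
      (D := fun z => χ (D (ψ z))) ?_ (by simp [hψ0, hD0]) ?_ ?_ ?_ hη
    · rw [← hψ0] at hD
      have := χ.hasFDerivAt.comp (0 : ℂ) (hD.comp (0 : ℂ) hψd)
      refine this.congr_fderiv ?_
      ext z
      simp [χ]
    · filter_upwards [hψ.eventually hDc] with z hz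
      exact χ.continuous.continuousAt.comp (ContinuousAt.comp hz hψc.continuousAt)
    · have h := hψp 0
      rw [hψ0] at h
      filter_upwards [h.eventually hEc] with p hp
      exact χ.continuous.continuousAt.comp
        (ContinuousAt.comp (f := ψ) (g := fun y => E y p.2) hp hψc.continuousAt)
    · filter_upwards [hψ.eventually hED] with z hz
      exact (χ.continuous.tendsto _).comp (hz.comp (hψp z))
  -- `Y ε` is chosen among the zeros of `E · ε` as almost the closest one to `y₀`.
  let Z : ℝ → Set (ℝ × ℝ) := fun ε => {y | E y ε = 0}
  have hZ : ∀ η > 0, ∀ᶠ ε in 𝓝[≠] (0 : ℝ), ∃ y ∈ Z ε, dist y₀ y < η := by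
    intro η hη
    obtain ⟨r, hr, hball⟩ := Metric.nhds_basis_closedBall.eventually_iff.1
      (hψ.eventually (Metric.ball_mem_nhds y₀ hη))
    filter_upwards [key r hr] with ε ⟨z, hz, hz0⟩
    exact ⟨ψ z, by simpa [Z] using hz0, by simpa [dist_comm] using hball hz⟩
  have hch : ∀ ε, ∃ y, ε ≠ 0 → (Z ε).Nonempty → y ∈ Z ε ∧
      dist y₀ y < Metric.infDist y₀ (Z ε) + |ε| := by
    intro ε
    by_cases h : ε ≠ 0 ∧ (Z ε).Nonempty
    · obtain ⟨y, hy, hy'⟩ := (Metric.infDist_lt_iff h.2).1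
        (lt_add_of_pos_right (Metric.infDist y₀ (Z ε)) (abs_pos.2 h.1))
      exact ⟨y, fun _ _ => ⟨hy, hy'⟩⟩
    · exact ⟨0, fun h1 h2 => absurd ⟨h1, h2⟩ h⟩
  choose Y hY using hch
  have hne : ∀ᶠ ε in 𝓝[≠] (0 : ℝ), ε ≠ 0 := eventually_mem_nhdsWithin
  refine ⟨Y, ?_, ?_⟩
  · filter_upwards [hne, hZ 1 one_pos] with ε h1 ⟨y, hy, _⟩
    exact (hY ε h1 ⟨y, hy⟩).1
  · rw [Metric.tendsto_nhds]
    intro η hη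
    have habs : ∀ᶠ ε in 𝓝[≠] (0 : ℝ), |ε| < η / 2 := by
      have : Tendsto (fun ε : ℝ => |ε|) (𝓝[≠] 0) (𝓝 |0|) :=
        (continuous_abs.tendsto 0).mono_left nhdsWithin_le_nhds
      rw [abs_zero] at this
      exact this.eventually (gt_mem_nhds (half_pos hη))
    filter_upwards [hne, hZ (η / 2) (half_pos hη), habs] with ε h1 ⟨y, hy, hyd⟩ h2
    have h3 := (hY ε h1 ⟨y, hy⟩).2
    have h4 := Metric.infDist_le_dist_of_mem (x := y₀) hy
    rw [dist_comm]
    linarith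

/-! ### Slowly varying differential equations -/

/-- Uniqueness for a `C¹` vector field, the differential equation being required only in the
interior of the interval. -/
theorem eqOn_Icc_of_hasDerivAt_Ioo {E : Type*} [NormedAddCommGroup E] [NormedSpace ℝ E]
    [ProperSpace E] {v : ℝ → E → E} (hv : ContDiff ℝ 1 (fun z : ℝ × E => v z.1 z.2))
    {f g : ℝ → E} {a b : ℝ}
    (hf : ContinuousOn f (Icc a b)) (hf' : ∀ t ∈ Ioo a b, HasDerivAt f (v t (f t)) t)
    (hg : ContinuousOn g (Icc a b)) (hg' : ∀ t ∈ Ioo a b, HasDerivAt g (v t (g t)) t)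
    (ha : f a = g a) : EqOn f g (Icc a b) := by
  rcases lt_or_ge a b with hab | hab
  swap
  · intro t ht
    obtain rfl : t = a := le_antisymm (ht.2.trans hab) ht.1
    exact ha
  have right : ∀ {f : ℝ → E}, ContinuousOn f (Icc a b) →
      (∀ t ∈ Ioo a b, HasDerivAt f (v t (f t)) t) →
      ∀ t ∈ Ico a b, HasDerivWithinAt f (v t (f t)) (Ici t) t := by
    intro f hf hf' t ht
    rcases eq_or_lt_of_le ht.1 with rfl | hat
    · refine hasDerivWithinAt_Ici_of_tendsto_deriv (s := Ioo a b)
        (fun t ht => (hf' t ht).differentiableAt.differentiableWithinAt)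
        ((hf a ⟨le_rfl, hab.le⟩).mono Ioo_subset_Icc_self) (Ioo_mem_nhdsGT hab) ?_
      have h1 : Tendsto f (𝓝[>] a) (𝓝 (f a)) :=
        ((hf a ⟨le_rfl, hab.le⟩).mono_of_mem_nhdsWithin (Icc_mem_nhdsGT hab))
      have h2 : Tendsto (fun t => v t (f t)) (𝓝[>] a) (𝓝 (v a (f a))) :=
        (hv.continuous.tendsto (a, f a)).comp
          ((tendsto_id.mono_left nhdsWithin_le_nhds).prodMk_nhds h1)
      refine h2.congr' ?_
      filter_upwards [Ioo_mem_nhdsGT hab] with t ht using (hf' t ht).deriv.symm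
    · exact (hf' t ⟨hat, ht.2⟩).hasDerivWithinAt
  obtain ⟨R, hR⟩ := (isCompact_Icc.image_of_continuousOn hf).isBounded.subset_closedBall 0
  obtain ⟨R', hR'⟩ := (isCompact_Icc.image_of_continuousOn hg).isBounded.subset_closedBall 0
  obtain ⟨K, hK⟩ := hv.locallyLipschitz.locallyLipschitzOn.exists_lipschitzOnWith_of_compact
    (isCompact_Icc.prod (isCompact_closedBall (0 : E) (max R R')) : IsCompact (Icc a b ×ˢ _))
  refine ODE_solution_unique_of_mem_Icc_right (K := K)
    (s := fun _ => Metric.closedBall (0 : E) (max R R')) ?_ hf (right hf hf') ?_ hg (right hg hg')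
    ?_ ha
  · intro t ht x hx y hy
    have := hK (x := (t, x)) ⟨Ico_subset_Icc_self ht, hx⟩ (y := (t, y))
      ⟨Ico_subset_Icc_self ht, hy⟩
    simpa [Prod.edist_eq] using this
  · exact fun t ht => Metric.closedBall_subset_closedBall (le_max_left _ _)
      (hR ⟨t, Ico_subset_Icc_self ht, rfl⟩)
  · exact fun t ht => Metric.closedBall_subset_closedBall (le_max_right _ _)
      (hR' ⟨t, Ico_subset_Icc_self ht, rfl⟩)

section SlowFlow

variable {E : Type*} [NormedAddCommGroup E] [NormedSpace ℝ E] [ProperSpace E]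
  {F : ℝ → E → ℝ → E} {U : Set E} {ε₁ : ℝ}

/-- Over a bounded time interval the equation `y' = ε F(t, y, ε)` has solutions that stay within
`C |ε|` of their initial value, for all small `ε` and all initial times. -/
theorem exists_slow_flow (hU : IsOpen U) (hε₁ : 0 < ε₁)
    (hF : ContDiffOn ℝ 1 (fun z : ℝ × E × ℝ => F z.1 z.2.1 z.2.2)
      (univ ×ˢ (U ×ˢ Ioo (-ε₁) ε₁))) {a b : ℝ} {y₀ : E} (hy₀ : y₀ ∈ U) :
    ∃ C : ℝ, ∃ R > 0, ∃ δ > 0, δ < ε₁ ∧ ∀ ε, |ε| ≤ δ → ∀ τ ∈ Icc a b, ∃ Y : E → ℝ → E,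
      (∀ y ∈ Metric.closedBall y₀ R, Y y τ = y ∧ ∀ t ∈ Icc a b,
        HasDerivWithinAt (Y y) (ε • F t (Y y t) ε) (Icc a b) t ∧ Y y t ∈ U ∧
          ‖Y y t - y‖ ≤ C * |ε|) ∧
      ∀ t ∈ Icc a b, ContinuousOn (fun y => Y y t) (Metric.closedBall y₀ R) := by
  obtain ⟨r, hr, hrU⟩ := Metric.nhds_basis_closedBall.mem_iff.1 (hU.mem_nhds hy₀)
  let Q : Set (ℝ × E × ℝ) :=
    Icc a b ×ˢ (Metric.closedBall y₀ r ×ˢ Icc (-(ε₁ / 2)) (ε₁ / 2))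
  have hQ : IsCompact Q := isCompact_Icc.prod ((isCompact_closedBall _ _).prod isCompact_Icc)
  have hQs : Q ⊆ univ ×ˢ (U ×ˢ Ioo (-ε₁) ε₁) := by
    rintro ⟨t, y, ε⟩ ⟨-, h2, h3, h4⟩
    refine ⟨trivial, hrU h2, ?_, ?_⟩
    · dsimp only at h3 ⊢; linarith
    · dsimp only at h4 ⊢; linarith
  have hopen : IsOpen ((univ : Set ℝ) ×ˢ (U ×ˢ Ioo (-ε₁) ε₁)) :=
    isOpen_univ.prod (hU.prod isOpen_Ioo)
  obtain ⟨M, hM⟩ := hQ.exists_bound_of_continuousOn (hF.continuousOn.mono hQs)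
  have hlip : LocallyLipschitzOn Q (fun z : ℝ × E × ℝ => F z.1 z.2.1 z.2.2) := by
    intro z hz
    obtain ⟨K, s, hs, hK⟩ := (hF.contDiffAt (hopen.mem_nhds (hQs hz))).exists_lipschitzOnWith
    exact ⟨K, s, mem_nhdsWithin_of_mem_nhds hs, hK⟩
  obtain ⟨K, hK⟩ := hlip.exists_lipschitzOnWith_of_compact hQ
  set M' : ℝ := max M 0 + 1
  have hM' : 0 < M' := by positivity
  have hMM' : ∀ z ∈ Q, ‖F z.1 z.2.1 z.2.2‖ ≤ M' := fun z hz => by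
    refine (hM z hz).trans ?_
    have := le_max_left M 0
    simp only [M']
    linarith
  set c : ℝ := |b - a| + 1
  have hc : 0 < c := by positivity
  set δ : ℝ := min (ε₁ / 2) (r / 2 / (M' * c))
  have hδ : 0 < δ := lt_min (by positivity) (by positivity)
  refine ⟨M' * c, r / 2, by positivity, δ, hδ, (min_le_left _ _).trans_lt (half_lt_self hε₁), ?_⟩
  intro ε hε τ hτ
  have hεc : ∀ t ∈ Icc a b, ∀ y ∈ Metric.closedBall y₀ r, (t, y, ε) ∈ Q := fun t ht y hy =>
    ⟨ht, hy, abs_le.1 (hε.trans (min_le_left _ _))⟩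
  have hsmall : M' * |ε| * c ≤ r / 2 := by
    have := hε.trans (min_le_right _ _)
    rw [le_div_iff₀ (by positivity)] at this
    linarith
  classical
  -- Outside the ball the field is set to zero, so that a bound on it holds along any solution.
  let v : ℝ → E → E := fun t y => if y ∈ Metric.closedBall y₀ r then ε • F t y ε else 0
  have hv : ∀ t y, y ∈ Metric.closedBall y₀ r → v t y = ε • F t y ε := fun t y hy => if_pos hy
  have hvb : ∀ t ∈ Icc a b, ∀ y, ‖v t y‖ ≤ M' * |ε| := by
    intro t ht y
    by_cases hy : y ∈ Metric.closedBall y₀ r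
    · rw [hv t y hy, norm_smul, Real.norm_eq_abs, mul_comm]
      exact mul_le_mul_of_nonneg_right (hMM' _ (hεc t ht y hy)) (abs_nonneg _)
    · simp only [v, if_neg hy, norm_zero]
      positivity
  have hpl : IsPicardLindelof v (⟨τ, hτ⟩ : Icc a b) y₀ (⟨r, hr.le⟩ : NNReal)
      (⟨r / 2, by positivity⟩ : NNReal) (⟨M' * |ε|, by positivity⟩ : NNReal)
      (‖ε‖₊ * K) := by
    refine ⟨fun t ht => ?_, fun y hy => ?_, fun t ht y _ => hvb t ht y, ?_⟩
    · refine LipschitzOnWith.of_dist_le_mul fun x hx y hy => ?_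
      rw [hv t x hx, hv t y hy, dist_smul₀, NNReal.coe_mul, coe_nnnorm, mul_assoc]
      refine mul_le_mul_of_nonneg_left ?_ (norm_nonneg _)
      have := hK.dist_le_mul _ (hεc t ht x hx) _ (hεc t ht y hy)
      simpa [Prod.dist_eq] using this
    · have : ContinuousOn (fun t => ε • F t y ε) (Icc a b) := by
        refine ContinuousOn.const_smul ?_ ε
        exact (hF.continuousOn.mono hQs).comp (f := fun t => (t, y, ε)) (by fun_prop)
          fun t ht => hεc t ht y hy
      exact this.congr fun t _ => hv t y hy
    · have h1 : max (b - τ) (τ - a) ≤ c := by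
        have := le_abs_self (b - a)
        simp only [c]
        exact max_le (by linarith [hτ.1]) (by linarith [hτ.2])
      calc M' * |ε| * max (b - τ) (τ - a) ≤ M' * |ε| * c := by gcongr
        _ ≤ r / 2 := hsmall
        _ = r - r / 2 := by ring
  obtain ⟨Y, hY, L, hL⟩ := hpl.exists_forall_mem_closedBall_eq_hasDerivWithinAt_lipschitzOnWith
  refine ⟨Y, fun y hy => ⟨(hY y hy).1, fun t ht => ?_⟩, fun t ht => (hL t ht).continuousOn⟩
  have hbd : ∀ t ∈ Icc a b, ‖Y y t - y‖ ≤ M' * |ε| * c := by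
    intro t ht
    have h1 := (convex_Icc a b).norm_image_sub_le_of_norm_hasDerivWithin_le
      (fun s hs => (hY y hy).2 s hs) (fun s hs => hvb s hs _) hτ ht
    have h2 : Y y τ = y := (hY y hy).1
    rw [h2] at h1
    refine h1.trans ?_
    have : ‖t - τ‖ ≤ c := by
      rw [Real.norm_eq_abs, abs_le]
      have := le_abs_self (b - a)
      simp only [c]
      constructor <;> linarith [hτ.1, hτ.2, ht.1, ht.2]
    gcongr
  have hmem : Y y t ∈ Metric.closedBall y₀ r := by
    have h1 := (hbd t ht).trans hsmall
    have h2 : dist y y₀ ≤ r / 2 := hy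
    rw [Metric.mem_closedBall]
    calc dist (Y y t) y₀ ≤ dist (Y y t) y + dist y y₀ := dist_triangle _ _ _
      _ ≤ r / 2 + r / 2 := add_le_add (by rwa [dist_eq_norm]) h2
      _ = r := by ring
  refine ⟨?_, hrU hmem, (hbd t ht).trans (le_of_eq (by ring))⟩
  have := (hY y hy).2 t ht
  rwa [hv t _ hmem] at this

/-- First-order averaging: the displacement of a solution of `y' = ε F(t, y, ε)` that stays within
`C |ε|` of its initial value is `ε ∫ F(t, y, 0) dt + o(ε)`. -/
theorem tendsto_slow_displacement (hU : IsOpen U) (hε₁ : 0 < ε₁)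
    (hF : ContinuousOn (fun z : ℝ × E × ℝ => F z.1 z.2.1 z.2.2)
      (univ ×ˢ (U ×ˢ Ioo (-ε₁) ε₁))) {a b C : ℝ} (hab : a ≤ b) {y : E} (hy : y ∈ U)
    {Y : E → ℝ → ℝ → E}
    (hY : ∀ᶠ p in 𝓝 y ×ˢ 𝓝[≠] (0 : ℝ), Y p.1 p.2 a = p.1 ∧ ∀ t ∈ Icc a b,
      HasDerivWithinAt (Y p.1 p.2) (p.2 • F t (Y p.1 p.2 t) p.2) (Icc a b) t ∧
        ‖Y p.1 p.2 t - p.1‖ ≤ C * |p.2|) :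
    Tendsto (fun p : E × ℝ => p.2⁻¹ • (Y p.1 p.2 b - p.1)) (𝓝 y ×ˢ 𝓝[≠] 0)
      (𝓝 (∫ t in a..b, F t y 0)) := by
  have hopen : IsOpen ((univ : Set ℝ) ×ˢ (U ×ˢ Ioo (-ε₁) ε₁)) :=
    isOpen_univ.prod (hU.prod isOpen_Ioo)
  have hF0 : Continuous fun t => F t y 0 := by
    rw [← continuousOn_univ]
    exact hF.comp (f := fun t => (t, y, (0 : ℝ))) (by fun_prop)
      fun t _ => ⟨trivial, hy, by simpa using hε₁⟩
  rw [Metric.tendsto_nhds]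
  intro η hη
  have hη' : 0 < η / (2 * (|b - a| + 1)) := by positivity
  have hclose : ∀ᶠ q : E × ℝ in 𝓝 (y, 0), ∀ t ∈ Icc a b,
      ‖F t q.1 q.2 - F t y 0‖ < η / (2 * (|b - a| + 1)) := by
    refine isCompact_Icc.eventually_forall_of_forall_eventually fun t _ => ?_
    have h1 : ContinuousAt (fun z : ℝ × E × ℝ => F z.1 z.2.1 z.2.2) (t, y, 0) :=
      hF.continuousAt (hopen.mem_nhds ⟨trivial, hy, by simpa using hε₁⟩)
    have h2 : Tendsto (fun z : (E × ℝ) × ℝ => F z.2 z.1.1 z.1.2 - F z.2 y 0) (𝓝 ((y, 0), t))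
        (𝓝 (F t y 0 - F t y 0)) := by
      refine Tendsto.sub ?_ ((hF0.tendsto t).comp (continuous_snd.tendsto _))
      exact h1.tendsto.comp (f := fun z : (E × ℝ) × ℝ => (z.2, z.1.1, z.1.2))
        (Continuous.tendsto (by fun_prop) _)
    rw [sub_self] at h2
    simpa using h2.eventually (Metric.ball_mem_nhds 0 hη')
  obtain ⟨r, hr, hball⟩ := Metric.nhds_basis_ball.eventually_iff.1 hclose
  have hp1 : ∀ᶠ p in 𝓝 y ×ˢ 𝓝[≠] (0 : ℝ), dist p.1 y < r / 2 :=
    tendsto_fst.eventually (Metric.ball_mem_nhds y (half_pos hr))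
  have hsnd : Tendsto (fun p : E × ℝ => |p.2|) (𝓝 y ×ˢ 𝓝[≠] (0 : ℝ)) (𝓝 0) := by
    have := (continuous_abs.tendsto (0 : ℝ)).comp
      ((tendsto_nhdsWithin_iff.1 (tendsto_snd (f := 𝓝 y) (g := 𝓝[≠] (0 : ℝ)))).1)
    simpa [Function.comp_def] using this
  have hp2 : ∀ᶠ p in 𝓝 y ×ˢ 𝓝[≠] (0 : ℝ), |p.2| < r := hsnd.eventually (gt_mem_nhds hr)
  have hp3 : ∀ᶠ p in 𝓝 y ×ˢ 𝓝[≠] (0 : ℝ), C * |p.2| < r / 2 := by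
    have := hsnd.const_mul C
    rw [mul_zero] at this
    exact this.eventually (gt_mem_nhds (half_pos hr))
  have hp4 : ∀ᶠ p in 𝓝 y ×ˢ 𝓝[≠] (0 : ℝ), p.2 ≠ 0 :=
    tendsto_snd.eventually eventually_mem_nhdsWithin
  filter_upwards [hY, hp1, hp2, hp3, hp4] with p ⟨h0, hode⟩ h1 h2 h3 h4
  have hmem : ∀ t ∈ Icc a b, ‖F t (Y p.1 p.2 t) p.2 - F t y 0‖ < η / (2 * (|b - a| + 1)) := by
    intro t ht
    refine hball (x := (Y p.1 p.2 t, p.2)) ?_ t ht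
    rw [Metric.mem_ball, Prod.dist_eq]
    refine max_lt ?_ (by simpa using h2)
    calc dist (Y p.1 p.2 t) y ≤ dist (Y p.1 p.2 t) p.1 + dist p.1 y := dist_triangle _ _ _
      _ < r / 2 + r / 2 := by
          refine add_lt_add_of_le_of_lt ?_ h1
          rw [dist_eq_norm]
          exact ((hode t ht).2.trans h3.le)
      _ = r := by ring
  have hder : ∀ t ∈ Icc a b, HasDerivWithinAt
      (fun t => Y p.1 p.2 t - p.2 • ∫ s in a..t, F s y 0)
      (p.2 • F t (Y p.1 p.2 t) p.2 - p.2 • F t y 0) (Icc a b) t := fun t ht =>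
    (hode t ht).1.sub
      (((hF0.integral_hasStrictDerivAt a t).hasDerivAt.const_smul p.2).hasDerivWithinAt)
  have hmv := (convex_Icc a b).norm_image_sub_le_of_norm_hasDerivWithin_le
    (C := |p.2| * (η / (2 * (|b - a| + 1)))) hder
    (fun t ht => by
      rw [← smul_sub, norm_smul, Real.norm_eq_abs]
      exact mul_le_mul_of_nonneg_left (hmem t ht).le (abs_nonneg _))
    ⟨le_rfl, hab⟩ ⟨hab, le_rfl⟩
  simp only [intervalIntegral.integral_same, smul_zero, sub_zero, h0] at hmv
  have hrew : p.2⁻¹ • (Y p.1 p.2 b - p.1) - ∫ s in a..b, F s y 0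
      = p.2⁻¹ • (Y p.1 p.2 b - p.2 • (∫ s in a..b, F s y 0) - p.1) := by
    rw [sub_right_comm, smul_sub _ (_ - _), smul_smul, inv_mul_cancel₀ h4, one_smul]
  rw [dist_eq_norm, hrew, norm_smul, norm_inv, Real.norm_eq_abs]
  have hpos : 0 < |p.2| := abs_pos.2 h4
  calc |p.2|⁻¹ * ‖Y p.1 p.2 b - p.2 • (∫ s in a..b, F s y 0) - p.1‖
      ≤ |p.2|⁻¹ * (|p.2| * (η / (2 * (|b - a| + 1))) * ‖b - a‖) := by gcongr
    _ = η * (|b - a| / (2 * (|b - a| + 1))) := by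
        rw [Real.norm_eq_abs]
        field_simp
    _ < η := by
        have : |b - a| / (2 * (|b - a| + 1)) < 1 := by
          rw [div_lt_one (by positivity)]
          linarith [abs_nonneg (b - a)]
        nlinarith

end SlowFlow

/-! ### Time–energy coordinates -/

/-- Translation of the time coordinate of a pair (time, energy). -/
def timeShift (t : ℝ) (y : ℝ × ℝ) : ℝ × ℝ := (t + y.1, y.2)

theorem contDiff_timeShift {n : WithTop ℕ∞} :
    ContDiff ℝ n (fun z : ℝ × (ℝ × ℝ) => timeShift z.1 z.2) := by
  unfold timeShift; fun_prop

theorem hamiltonianField_contDiff {H : ℝ × ℝ → ℝ} (hH : ContDiff ℝ 4 H) :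
    ContDiff ℝ 1 (hamiltonianField H) := by
  have h : ContDiff ℝ 1 (fderiv ℝ H) := (hH.fderiv_right (m := 3) (by norm_num)).of_le (by norm_num)
  unfold hamiltonianField
  fun_prop

namespace PeriodicFamily

variable {H : ℝ × ℝ → ℝ} (A : PeriodicFamily H)

/-- The parametrization `(s, h) ↦ q(s, h)` of the annulus by time and energy. -/
def param (y : ℝ × ℝ) : ℝ × ℝ := A.q y.1 y.2

/-- The domain `ℝ × V` of the time–energy parametrization. -/
def domain : Set (ℝ × ℝ) := univ ×ˢ A.V

/-- The derivative of the time–energy parametrization in the energy. -/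
def transverse (y : ℝ × ℝ) : ℝ × ℝ := fderiv ℝ A.param y (0, 1)

/-- The inverse of the derivative of the time–energy parametrization. Its determinant is `1`, since
the energy of `q(s, h)` is `h`, so no division occurs. -/
def slow (y : ℝ × ℝ) : ℝ × ℝ →L[ℝ] ℝ × ℝ :=
  ((A.transverse y).2 • ContinuousLinearMap.fst ℝ ℝ ℝ
    - (A.transverse y).1 • ContinuousLinearMap.snd ℝ ℝ ℝ).prod (fderiv ℝ H (A.param y))

theorem slow_apply (y v : ℝ × ℝ) : A.slow y v =
    ((A.transverse y).2 * v.1 - (A.transverse y).1 * v.2, fderiv ℝ H (A.param y) v) := by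
  simp [slow]

theorem isOpen_domain : IsOpen A.domain := isOpen_univ.prod A.V_open

variable {A}

theorem timeShift_mem_domain {t : ℝ} {y : ℝ × ℝ} (hy : y ∈ A.domain) :
    timeShift t y ∈ A.domain := ⟨trivial, hy.2⟩

theorem contDiffOn_param : ContDiffOn ℝ 3 A.param A.domain := A.q_smooth

theorem contDiffAt_param {y : ℝ × ℝ} (hy : y ∈ A.domain) : ContDiffAt ℝ 3 A.param y :=
  contDiffOn_param.contDiffAt (A.isOpen_domain.mem_nhds hy)

theorem hasFDerivAt_param {y : ℝ × ℝ} (hy : y ∈ A.domain) :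
    HasFDerivAt A.param (fderiv ℝ A.param y) y :=
  ((contDiffAt_param hy).differentiableAt (by norm_num)).hasFDerivAt

theorem hasDerivAt_param_energy {y : ℝ × ℝ} (hy : y ∈ A.domain) :
    HasDerivAt (fun h => A.q y.1 h) (A.transverse y) y.2 := by
  have h1 : HasDerivAt (fun h : ℝ => (y.1, h)) ((0 : ℝ), (1 : ℝ)) y.2 :=
    (hasDerivAt_const y.2 y.1).prodMk (hasDerivAt_id y.2)
  exact (hasFDerivAt_param (y := (y.1, y.2)) hy).comp_hasDerivAt y.2 h1

theorem fderiv_param_time {y : ℝ × ℝ} (hy : y ∈ A.domain) :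
    fderiv ℝ A.param y (1, 0) = hamiltonianField H (A.param y) := by
  have h1 : HasDerivAt (fun s : ℝ => (s, y.2)) ((1 : ℝ), (0 : ℝ)) y.1 :=
    (hasDerivAt_id y.1).prodMk (hasDerivAt_const y.1 y.2)
  have h0 : HasFDerivAt A.param (fderiv ℝ A.param y) (y.1, y.2) := hasFDerivAt_param hy
  have h2 := h0.comp_hasDerivAt y.1 h1
  exact h2.unique (A.q_ode y.2 hy.2 y.1)

theorem fderiv_param_apply {y : ℝ × ℝ} (hy : y ∈ A.domain) (v : ℝ × ℝ) :
    fderiv ℝ A.param y v = v.1 • hamiltonianField H (A.param y) + v.2 • A.transverse y := by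
  rw [← fderiv_param_time hy, transverse, ← map_smul, ← map_smul, ← map_add]
  simp

theorem fderiv_hamiltonian_apply (x v : ℝ × ℝ) :
    fderiv ℝ H x v = v.1 * fderiv ℝ H x (1, 0) + v.2 * fderiv ℝ H x (0, 1) := by
  rw [← smul_eq_mul, ← smul_eq_mul, ← map_smul, ← map_smul, ← map_add]
  simp

theorem fderiv_hamiltonian_transverse (hH : Differentiable ℝ H) {y : ℝ × ℝ} (hy : y ∈ A.domain) :
    fderiv ℝ H (A.param y) (A.transverse y) = 1 := by
  have h1 := (hH (A.q y.1 y.2)).hasFDerivAt.comp_hasDerivAt y.2 (hasDerivAt_param_energy hy)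
  have h2 : (H ∘ fun h => A.q y.1 h) =ᶠ[𝓝 y.2] id := by
    filter_upwards [A.V_open.mem_nhds hy.2] with x hx using A.q_level x hx _
  exact (h1.congr_of_eventuallyEq h2.symm).unique (hasDerivAt_id y.2)

theorem slow_fderiv_param (hH : Differentiable ℝ H) {y : ℝ × ℝ} (hy : y ∈ A.domain) (v : ℝ × ℝ) :
    A.slow y (fderiv ℝ A.param y v) = v := by
  have h := fderiv_hamiltonian_transverse hH hy
  rw [fderiv_param_apply hy, slow_apply, map_add, map_smul, map_smul, h]
  rw [fderiv_hamiltonian_apply] at h ⊢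
  ext <;> simp [hamiltonianField]
  · linear_combination v.1 * h
  · exact Or.inr (by ring)

theorem fderiv_param_slow (hH : Differentiable ℝ H) {y : ℝ × ℝ} (hy : y ∈ A.domain) (v : ℝ × ℝ) :
    fderiv ℝ A.param y (A.slow y v) = v := by
  have h := fderiv_hamiltonian_transverse hH hy
  rw [fderiv_param_apply hy, slow_apply]
  rw [fderiv_hamiltonian_apply] at h ⊢
  ext <;> simp [hamiltonianField]
  · linear_combination v.1 * h
  · linear_combination v.2 * h

/-- The derivative of the time–energy parametrization as a linear equivalence. -/
def paramDeriv (hH : Differentiable ℝ H) {y : ℝ × ℝ} (hy : y ∈ A.domain) :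
    (ℝ × ℝ) ≃L[ℝ] (ℝ × ℝ) :=
  ContinuousLinearEquiv.equivOfInverse (fderiv ℝ A.param y) (A.slow y)
    (slow_fderiv_param hH hy) (fderiv_param_slow hH hy)

theorem contDiffOn_transverse : ContDiffOn ℝ 1 A.transverse A.domain := by
  have h : ContDiffOn ℝ 1 (fderiv ℝ A.param) A.domain :=
    contDiffOn_param.fderiv_of_isOpen A.isOpen_domain (by norm_num)
  exact h.clm_apply contDiffOn_const

theorem contDiffOn_slow (hH : ContDiff ℝ 4 H) {Z : Type*} [NormedAddCommGroup Z] [NormedSpace ℝ Z]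
    {s : Set Z} {c w : Z → ℝ × ℝ} (hc : ContDiffOn ℝ 1 c s) (hcs : MapsTo c s A.domain)
    (hw : ContDiffOn ℝ 1 w s) : ContDiffOn ℝ 1 (fun z => A.slow (c z) (w z)) s := by
  have h1 : ContDiffOn ℝ 1 (fun z => A.transverse (c z)) s := contDiffOn_transverse.comp hc hcs
  have h2 : ContDiffOn ℝ 1 (fun z => A.param (c z)) s :=
    (contDiffOn_param.of_le (by norm_num)).comp hc hcs
  have h3 : ContDiff ℝ 1 (fderiv ℝ H) :=
    (hH.fderiv_right (m := 3) (by norm_num)).of_le (by norm_num)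
  simp only [slow_apply]
  exact ((h1.snd.mul hw.fst).sub (h1.fst.mul hw.snd)).prodMk ((h3.comp_contDiffOn h2).clm_apply hw)

/-- A solution `Y` of the slow equation `Y' = ε DΦ⁻¹ g`, the inverse derivative of the
parametrization `Φ` being taken at `(t, 0) + Y`, gives the solution `Φ((t, 0) + Y)` of the
perturbed Hamiltonian equation. -/
theorem hasDerivWithinAt_param (hH : Differentiable ℝ H) {Y : ℝ → ℝ × ℝ} {s : Set ℝ} {t ε : ℝ}
    {v : ℝ × ℝ} (hYt : Y t ∈ A.domain)
    (hY : HasDerivWithinAt Y (ε • A.slow (timeShift t (Y t)) v) s t) :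
    HasDerivWithinAt (fun t => A.param (timeShift t (Y t)))
      (hamiltonianField H (A.param (timeShift t (Y t))) + ε • v) s t := by
  have hm := timeShift_mem_domain (t := t) hYt
  have h1 : HasDerivWithinAt (fun t => timeShift t (Y t))
      ((1, 0) + ε • A.slow (timeShift t (Y t)) v) s t := by
    have := ((hasDerivWithinAt_id t s).prodMk (hasDerivWithinAt_const t s (0 : ℝ))).add hY
    refine this.congr_of_eventuallyEq (Eventually.of_forall fun x => ?_) ?_ <;>
    simp [timeShift, Prod.ext_iff]
  refine ((hasFDerivAt_param hm).comp_hasDerivWithinAt t h1).congr_deriv ?_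
  rw [map_add, map_smul, fderiv_param_slow hH hm, fderiv_param_time hm]

/-- In an isochronous family the row vector `α` is, up to the frequency, the first row of the
inverse derivative of the time–energy parametrization. -/
theorem rowMul_α {T₀ : ℝ} (hH : Differentiable ℝ H) (hiso : ∀ h ∈ A.V, A.per h = T₀) {s r : ℝ}
    (hr : r ∈ A.V) (v : ℝ × ℝ) :
    rowMul (A.α (A.Ω r * s) r) v = A.Ω r * (A.slow (s, r) v).1 := by
  have hΩ : 0 < A.Ω r := by
    have := A.per_pos r hr
    unfold Ω; positivity
  have hdiv : A.Ω r * s / A.Ω r = s := by field_simp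
  have hy : ((s, r) : ℝ × ℝ) ∈ A.domain := ⟨trivial, hr⟩
  have hDh : A.DhG (A.Ω r * s) r = A.transverse (s, r) := by
    have h1 : (fun h => A.G (A.Ω r * s) h) =ᶠ[𝓝 r] fun h => A.q s h := by
      filter_upwards [A.V_open.mem_nhds hr] with h hh
      have : A.Ω h = A.Ω r := by rw [Ω, Ω, hiso h hh, hiso r hr]
      rw [G, this, hdiv]
    rw [DhG, h1.deriv_eq]
    exact (hasDerivAt_param_energy hy).deriv
  have hDθ : A.DθG (A.Ω r * s) r = (A.Ω r)⁻¹ • hamiltonianField H (A.param (s, r)) := by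
    have h1 := A.q_ode r hr (A.Ω r * s / A.Ω r)
    have h2 : HasDerivAt (fun θ' : ℝ => θ' / A.Ω r) (A.Ω r)⁻¹ (A.Ω r * s) := by
      simpa using (hasDerivAt_id (A.Ω r * s)).div_const (A.Ω r)
    have h3 := (h1.scomp (A.Ω r * s) h2).deriv
    rw [hdiv] at h3
    exact h3
  have h := fderiv_hamiltonian_transverse hH hy
  rw [fderiv_hamiltonian_apply] at h
  have hdet : rowMul (-(A.transverse (s, r)).2, (A.transverse (s, r)).1)
      ((A.Ω r)⁻¹ • hamiltonianField H (A.param (s, r))) = -(A.Ω r)⁻¹ := by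
    simp only [rowMul, hamiltonianField, Prod.smul_mk, smul_eq_mul]
    linear_combination (-(A.Ω r)⁻¹) * h
  rw [α, hDh, hDθ, hdet, slow_apply]
  simp only [rowMul, Prod.smul_mk, smul_eq_mul, inv_neg, inv_inv]
  ring

theorem param_timeShift_add_period {y : ℝ × ℝ} (hy : y ∈ A.domain) {T₀ t : ℝ}
    (hiso : ∀ h ∈ A.V, A.per h = T₀) (K : ℕ) :
    A.param (timeShift (t + K * T₀) y) = A.param (timeShift t y) := by
  have h := (A.q_periodic y.2 hy.2).nat_mul K (t + y.1)
  rw [hiso _ hy.2] at h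
  simp only [param, timeShift]
  rw [← h]
  ring_nf

theorem slow_timeShift_add_period {y : ℝ × ℝ} (hy : y ∈ A.domain) {T₀ t : ℝ}
    (hiso : ∀ h ∈ A.V, A.per h = T₀) (K : ℕ) :
    A.slow (timeShift (t + K * T₀) y) = A.slow (timeShift t y) := by
  have h1 : A.transverse (timeShift (t + K * T₀) y) = A.transverse (timeShift t y) := by
    refine (hasDerivAt_param_energy (timeShift_mem_domain hy)).unique
      ((hasDerivAt_param_energy (timeShift_mem_domain hy)).congr_of_eventuallyEq ?_)
    filter_upwards [A.V_open.mem_nhds hy.2] with h hh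
    exact param_timeShift_add_period (y := (y.1, h)) ⟨trivial, hh⟩ hiso K
  rw [slow, slow, h1, param_timeShift_add_period hy hiso K]

end PeriodicFamily

/-! ### Families of maps near the identity -/

section NearIdentity

theorem tendsto_param_zero {X : Type*} {l : Filter X} :
    Tendsto (fun p : X × ℝ => p.2) (l ×ˢ 𝓝[≠] (0 : ℝ)) (𝓝 0) :=
  (tendsto_snd (f := l)).mono_right nhdsWithin_le_nhds

theorem eventually_param_ne_zero {X : Type*} {l : Filter X} :
    ∀ᶠ p : X × ℝ in l ×ˢ 𝓝[≠] (0 : ℝ), p.2 ≠ 0 :=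
  tendsto_snd.eventually eventually_mem_nhdsWithin

variable {E : Type*} [NormedAddCommGroup E] [NormedSpace ℝ E]

/-- The maps `W · ε` are continuous and satisfy `W y ε = y + ε D y + o(ε)`, locally uniformly for
`y` near `y₀`, as `ε → 0` with `ε ≠ 0`. -/
def IsNearIdentity (W : E → ℝ → E) (D : E → E) (y₀ : E) : Prop :=
  (∀ᶠ p in 𝓝 y₀ ×ˢ 𝓝[≠] (0 : ℝ), ContinuousAt (fun y => W y p.2) p.1) ∧
  ∀ᶠ y in 𝓝 y₀, Tendsto (fun p : E × ℝ => p.2⁻¹ • (W p.1 p.2 - p.1)) (𝓝 y ×ˢ 𝓝[≠] 0) (𝓝 (D y))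

theorem tendsto_of_displacement {W : E → ℝ → E} {y d : E}
    (h : Tendsto (fun p : E × ℝ => p.2⁻¹ • (W p.1 p.2 - p.1)) (𝓝 y ×ˢ 𝓝[≠] 0) (𝓝 d)) :
    Tendsto (fun p : E × ℝ => (W p.1 p.2, p.2)) (𝓝 y ×ˢ 𝓝[≠] 0) (𝓝 y ×ˢ 𝓝[≠] 0) := by
  refine Tendsto.prodMk ?_ tendsto_snd
  have h1 := (tendsto_fst (f := 𝓝 y) (g := 𝓝[≠] (0 : ℝ))).add (tendsto_param_zero.smul h)
  rw [zero_smul, add_zero] at h1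
  refine h1.congr' ?_
  filter_upwards [eventually_param_ne_zero] with p hp
  rw [smul_smul, mul_inv_cancel₀ hp, one_smul, add_sub_cancel]

theorem IsNearIdentity.tendsto {W : E → ℝ → E} {D : E → E} {y₀ : E} (h : IsNearIdentity W D y₀) :
    Tendsto (fun p : E × ℝ => (W p.1 p.2, p.2)) (𝓝 y₀ ×ˢ 𝓝[≠] 0) (𝓝 y₀ ×ˢ 𝓝[≠] 0) :=
  tendsto_of_displacement h.2.self_of_nhds

theorem IsNearIdentity.id (y₀ : E) : IsNearIdentity (fun y _ => y) (fun _ => 0) y₀ :=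
  ⟨Eventually.of_forall fun _ => continuousAt_id,
    Eventually.of_forall fun y => by simp⟩

theorem IsNearIdentity.comp {W₁ W₂ : E → ℝ → E} {D₁ D₂ : E → E} {y₀ : E}
    (h₁ : IsNearIdentity W₁ D₁ y₀) (h₂ : IsNearIdentity W₂ D₂ y₀) :
    IsNearIdentity (fun y ε => W₂ (W₁ y ε) ε) (fun y => D₁ y + D₂ y) y₀ := by
  refine ⟨?_, ?_⟩
  · filter_upwards [h₁.1, h₁.tendsto.eventually h₂.1] with p hp1 hp2
    exact ContinuousAt.comp (f := fun y => W₁ y p.2) (g := fun y => W₂ y p.2) hp2 hp1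
  · filter_upwards [h₁.2, h₂.2] with y hy1 hy2
    refine (hy1.add (hy2.comp (tendsto_of_displacement hy1))).congr fun p => ?_
    simp only [Function.comp_apply]
    rw [← smul_add]
    congr 1
    abel

variable [ProperSpace E] {F : ℝ → E → ℝ → E} {U : Set E} {ε₁ : ℝ}

/-- The flow of `y' = ε F(t, y, ε)` over a fixed time interval is near the identity, with
displacement `∫ F(t, y, 0) dt`. -/
theorem exists_flow_nearIdentity (hU : IsOpen U) (hε₁ : 0 < ε₁)
    (hF : ContDiffOn ℝ 1 (fun z : ℝ × E × ℝ => F z.1 z.2.1 z.2.2)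
      (univ ×ˢ (U ×ˢ Ioo (-ε₁) ε₁))) {a b : ℝ} (hab : a ≤ b) {y₀ : E} (hy₀ : y₀ ∈ U) :
    ∃ Y : E → ℝ → ℝ → E, IsNearIdentity (fun y ε => Y y ε b) (fun y => ∫ t in a..b, F t y 0) y₀ ∧
      (∀ᶠ p in 𝓝 y₀ ×ˢ 𝓝[≠] (0 : ℝ), Y p.1 p.2 a = p.1 ∧ ∀ t ∈ Icc a b,
        HasDerivWithinAt (Y p.1 p.2) (p.2 • F t (Y p.1 p.2 t) p.2) (Icc a b) t ∧
          Y p.1 p.2 t ∈ U) ∧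
      ∀ t ∈ Icc a b, Tendsto (fun p : E × ℝ => Y p.1 p.2 t) (𝓝 y₀ ×ˢ 𝓝[≠] 0) (𝓝 y₀) := by
  obtain ⟨C, R, hR, δ, hδ, hδε, h⟩ := exists_slow_flow hU hε₁ hF (a := a) (b := b) hy₀
  have h' := fun ε hε => h ε hε a ⟨le_rfl, hab⟩
  choose! Y hY using h'
  have hδ' : ∀ y : E, ∀ᶠ p in 𝓝 y ×ˢ 𝓝[≠] (0 : ℝ), |p.2| ≤ δ := fun y => by
    have := (continuous_abs.tendsto (0 : ℝ)).comp (tendsto_param_zero (l := 𝓝 y))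
    rw [abs_zero] at this
    exact (this.eventually (gt_mem_nhds hδ)).mono fun _ hp => le_of_lt hp
  have hball : ∀ y ∈ Metric.ball y₀ R, ∀ᶠ p in 𝓝 y ×ˢ 𝓝[≠] (0 : ℝ), p.1 ∈ Metric.ball y₀ R :=
    fun y hy => tendsto_fst.eventually (Metric.isOpen_ball.mem_nhds hy)
  have hsub := Metric.ball_subset_closedBall (x := y₀) (ε := R)
  have hy₀b := Metric.mem_ball_self (x := y₀) hR
  refine ⟨fun y ε t => Y ε y t, ⟨?_, ?_⟩, ?_, ?_⟩
  · filter_upwards [hδ' y₀, hball y₀ hy₀b] with p h1 h2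
    exact ((hY p.2 h1).2 b ⟨hab, le_rfl⟩).continuousAt
      (mem_of_superset (Metric.isOpen_ball.mem_nhds h2) hsub)
  · filter_upwards [Metric.isOpen_ball.mem_nhds hy₀b, hU.mem_nhds hy₀] with y hy hyU
    refine tendsto_slow_displacement (Y := fun y ε t => Y ε y t) hU hε₁ hF.continuousOn hab hyU
      (C := C) ?_
    filter_upwards [hδ' y, hball y hy] with p h1 h2
    have h3 := (hY p.2 h1).1 p.1 (hsub h2)
    exact ⟨h3.1, fun t ht => ⟨(h3.2 t ht).1, (h3.2 t ht).2.2⟩⟩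
  · filter_upwards [hδ' y₀, hball y₀ hy₀b] with p h1 h2
    have h3 := (hY p.2 h1).1 p.1 (hsub h2)
    exact ⟨h3.1, fun t ht => ⟨(h3.2 t ht).1, (h3.2 t ht).2.1⟩⟩
  · intro t ht
    have h1 : Tendsto (fun p : E × ℝ => Y p.2 p.1 t - p.1) (𝓝 y₀ ×ˢ 𝓝[≠] 0) (𝓝 0) := by
      have h2 : Tendsto (fun p : E × ℝ => C * |p.2|) (𝓝 y₀ ×ˢ 𝓝[≠] 0) (𝓝 0) := by
        have := ((continuous_abs.tendsto (0 : ℝ)).comp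
          (tendsto_param_zero (l := 𝓝 y₀))).const_mul C
        simpa [Function.comp_def] using this
      refine squeeze_zero_norm' ?_ h2
      filter_upwards [hδ' y₀, hball y₀ hy₀b] with p h1 h2
      exact (((hY p.2 h1).1 p.1 (hsub h2)).2 t ht).2.2
    have := h1.add (tendsto_fst (f := 𝓝 y₀) (g := 𝓝[≠] (0 : ℝ)))
    simpa using this

end NearIdentity

/-! ### Impulses and arcs in time–energy coordinates -/

namespace ImpulsiveHamiltonianSystem

variable {S : ImpulsiveHamiltonianSystem} {A : PeriodicFamily S.H}

variable (S) in
/-- The right-hand side `f(x) + ε g(t, x, ε)` of the system between the impulsive moments. -/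
def field (ε t : ℝ) (x : ℝ × ℝ) : ℝ × ℝ := hamiltonianField S.H x + ε • S.g t x ε

variable (S A) in
/-- The perturbation `g` in time–energy coordinates moving with the unperturbed flow. -/
def slowField (t : ℝ) (y : ℝ × ℝ) (ε : ℝ) : ℝ × ℝ :=
  A.slow (timeShift t y) (S.g t (A.param (timeShift t y)) ε)

variable (S A) in
/-- The impulse `l_k` at first order in time–energy coordinates. -/
def slowImpulse (k : ℤ) (y : ℝ × ℝ) (ε : ℝ) : ℝ × ℝ :=
  A.slow (timeShift (S.t k) y) (S.l k (A.param (timeShift (S.t k) y)) ε)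

theorem H_differentiable (S : ImpulsiveHamiltonianSystem) : Differentiable ℝ S.H :=
  S.H_smooth.differentiable (by norm_num)

theorem zero_mem_Ioo (S : ImpulsiveHamiltonianSystem) : (0 : ℝ) ∈ Ioo (-S.ε₁) S.ε₁ := by
  have := S.ε₁_pos
  constructor <;> linarith

theorem eventually_mem_Ioo (S : ImpulsiveHamiltonianSystem) :
    ∀ᶠ ε in 𝓝[≠] (0 : ℝ), ε ∈ Ioo (-S.ε₁) S.ε₁ :=
  mem_nhdsWithin_of_mem_nhds (isOpen_Ioo.mem_nhds S.zero_mem_Ioo)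

theorem contDiff_field {ε : ℝ} (hε : ε ∈ Ioo (-S.ε₁) S.ε₁) :
    ContDiff ℝ 1 (fun z : ℝ × (ℝ × ℝ) => S.field ε z.1 z.2) := by
  have h1 : ContDiff ℝ 1 (fun z : ℝ × (ℝ × ℝ) => S.g z.1 z.2 ε) := by
    rw [← contDiffOn_univ]
    exact (S.g_smooth.of_le (by norm_num)).comp
      (f := fun z : ℝ × (ℝ × ℝ) => (z.1, z.2, ε)) (by fun_prop)
      fun z _ => ⟨trivial, trivial, hε⟩
  exact ((hamiltonianField_contDiff S.H_smooth).comp contDiff_snd).add (h1.const_smul ε)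

theorem contDiffOn_slowField : ContDiffOn ℝ 1
    (fun z : ℝ × (ℝ × ℝ) × ℝ => slowField S A z.1 z.2.1 z.2.2)
    (univ ×ˢ (A.domain ×ˢ Ioo (-S.ε₁) S.ε₁)) := by
  have hc : ContDiffOn ℝ 1 (fun z : ℝ × (ℝ × ℝ) × ℝ => timeShift z.1 z.2.1)
      (univ ×ˢ (A.domain ×ˢ Ioo (-S.ε₁) S.ε₁)) :=
    (contDiff_timeShift.comp (f := fun z : ℝ × (ℝ × ℝ) × ℝ => (z.1, z.2.1))
      (by fun_prop)).contDiffOn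
  have hm : MapsTo (fun z : ℝ × (ℝ × ℝ) × ℝ => timeShift z.1 z.2.1)
      (univ ×ˢ (A.domain ×ˢ Ioo (-S.ε₁) S.ε₁)) A.domain :=
    fun z hz => timeShift_mem_domain hz.2.1
  refine contDiffOn_slow S.H_smooth hc hm ?_
  have hp : ContDiffOn ℝ 1 (fun z : ℝ × (ℝ × ℝ) × ℝ => A.param (timeShift z.1 z.2.1))
      (univ ×ˢ (A.domain ×ˢ Ioo (-S.ε₁) S.ε₁)) :=
    (contDiffOn_param.of_le (by norm_num)).comp hc hm
  refine (S.g_smooth.of_le (by norm_num)).comp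
    (f := fun z : ℝ × (ℝ × ℝ) × ℝ => (z.1, A.param (timeShift z.1 z.2.1), z.2.2)) ?_ ?_
  · exact contDiffOn_fst.prodMk (hp.prodMk contDiffOn_snd.snd)
  · exact fun z hz => ⟨trivial, trivial, hz.2.2⟩

theorem hasFDerivAt_param_timeShift (t : ℝ) {y : ℝ × ℝ} (hy : y ∈ A.domain) :
    HasFDerivAt (fun y => A.param (timeShift t y))
      (paramDeriv S.H_differentiable (timeShift_mem_domain (t := t) hy) : ℝ × ℝ →L[ℝ] ℝ × ℝ) y := by
  have h1 : HasFDerivAt (timeShift t) (ContinuousLinearMap.id ℝ (ℝ × ℝ)) y :=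
    (((hasFDerivAt_fst (𝕜 := ℝ) (p := y)).const_add t).prodMk hasFDerivAt_snd).congr_fderiv (by
      ext <;> simp)
  exact (hasFDerivAt_param (timeShift_mem_domain hy)).comp y h1

theorem contDiffAt_param_timeShift (t : ℝ) {y : ℝ × ℝ} (hy : y ∈ A.domain) :
    ContDiffAt ℝ 1 (fun y => A.param (timeShift t y)) y :=
  ((contDiffAt_param (timeShift_mem_domain hy)).of_le (by norm_num)).comp y
    (contDiff_timeShift.comp (f := fun y : ℝ × ℝ => (t, y)) (by fun_prop)).contDiffAt

/-- The time–energy parametrization is locally injective. -/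
theorem eventually_param_injective (t : ℝ) {y₀ : ℝ × ℝ} (hy₀ : y₀ ∈ A.domain) :
    ∃ u ∈ 𝓝 y₀, InjOn (fun y => A.param (timeShift t y)) u := by
  let e := (contDiffAt_param_timeShift t hy₀).toOpenPartialHomeomorph _
    (hasFDerivAt_param_timeShift t hy₀) one_ne_zero
  exact ⟨e.source, e.open_source.mem_nhds (ContDiffAt.mem_toOpenPartialHomeomorph_source _
    (hasFDerivAt_param_timeShift t hy₀) one_ne_zero), e.injOn⟩

/-- The impulse at `t_k` in time–energy coordinates. The impulses `l_k` are only continuous in `ε`,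
so the maps need not be jointly differentiable in `(y, ε)`. -/
theorem exists_impulse_nearIdentity (k : ℤ) {y₀ : ℝ × ℝ} (hy₀ : y₀ ∈ A.domain) :
    ∃ J : ℝ × ℝ → ℝ → ℝ × ℝ, IsNearIdentity J (fun y => slowImpulse S A k y 0) y₀ ∧
      ∀ᶠ p in 𝓝 y₀ ×ˢ 𝓝[≠] (0 : ℝ), A.param (timeShift (S.t k) (J p.1 p.2)) =
        A.param (timeShift (S.t k) p.1) +
          p.2 • S.l k (A.param (timeShift (S.t k) p.1)) p.2 := by
  set P : ℝ × ℝ → ℝ × ℝ := fun y => A.param (timeShift (S.t k) y) with hPdef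
  let e := (contDiffAt_param_timeShift (S.t k) hy₀).toOpenPartialHomeomorph P
    (hasFDerivAt_param_timeShift (S.t k) hy₀) one_ne_zero
  have he : ∀ y, e y = P y := fun _ => rfl
  have hy₀e : y₀ ∈ e.source := ContDiffAt.mem_toOpenPartialHomeomorph_source _
    (hasFDerivAt_param_timeShift (S.t k) hy₀) one_ne_zero
  have hPc : ∀ y ∈ A.domain, ContinuousAt P y := fun y hy =>
    (contDiffAt_param_timeShift (S.t k) hy).continuousAt
  let w : (ℝ × ℝ) × ℝ → ℝ × ℝ := fun p => P p.1 + p.2 • S.l k (P p.1) p.2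
  have hlim : ∀ y ∈ A.domain, Tendsto (fun p : (ℝ × ℝ) × ℝ => S.l k (P p.1) p.2)
      (𝓝 y ×ˢ 𝓝[≠] 0) (𝓝 (S.l k (P y) 0)) := by
    intro y hy
    have h1 : ContinuousAt (fun z : (ℝ × ℝ) × ℝ => S.l k z.1 z.2) (P y, 0) :=
      (S.l_continuous k).continuousAt
        ((isOpen_univ.prod isOpen_Ioo).mem_nhds ⟨trivial, S.zero_mem_Ioo⟩)
    exact h1.tendsto.comp
      (((hPc y hy).tendsto.comp tendsto_fst).prodMk_nhds tendsto_param_zero)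
  have hw : ∀ y ∈ A.domain, Tendsto w (𝓝 y ×ˢ 𝓝[≠] 0) (𝓝 (P y)) := by
    intro y hy
    have := ((hPc y hy).tendsto.comp (tendsto_fst (g := 𝓝[≠] (0 : ℝ)))).add
      (tendsto_param_zero.smul (hlim y hy))
    simpa [w, Function.comp_def] using this
  have hwt : ∀ᶠ p in 𝓝 y₀ ×ˢ 𝓝[≠] (0 : ℝ), w p ∈ e.target :=
    (hw y₀ hy₀).eventually (e.open_target.mem_nhds (he y₀ ▸ e.map_source hy₀e))
  refine ⟨fun y ε => e.symm (w (y, ε)), ⟨?_, ?_⟩, ?_⟩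
  · filter_upwards [hwt, tendsto_fst.eventually (A.isOpen_domain.mem_nhds hy₀),
      tendsto_snd.eventually S.eventually_mem_Ioo] with p h1 h2 h3
    have h4 : ContinuousAt (fun y => w (y, p.2)) p.1 :=
      (hPc _ h2).add (ContinuousAt.const_smul (ContinuousAt.comp (f := P)
        (g := fun x => S.l k x p.2) (S.l_smooth k p.2 h3).continuous.continuousAt (hPc _ h2)) p.2)
    exact ContinuousAt.comp (f := fun y => w (y, p.2)) (e.continuousAt_symm h1) h4
  · filter_upwards [A.isOpen_domain.mem_nhds hy₀, e.open_source.mem_nhds hy₀e] with y hy hye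
    have hPy : P y ∈ e.target := he y ▸ e.map_source hye
    have hsy : e.symm (P y) = y := e.left_inv hye
    let B := paramDeriv S.H_differentiable (timeShift_mem_domain (t := S.t k) hy)
    have hB : HasFDerivAt e (B : ℝ × ℝ →L[ℝ] ℝ × ℝ) (e.symm (P y)) := by
      rw [hsy]; exact hasFDerivAt_param_timeShift (S.t k) hy
    have hstrict : HasStrictFDerivAt e.symm (B.symm : ℝ × ℝ →L[ℝ] ℝ × ℝ) (P y) := by
      refine ContDiffAt.hasStrictFDerivAt' (n := 1) (e.contDiffAt_symm hPy hB ?_)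
        (e.hasFDerivAt_symm hPy hB) one_ne_zero
      rw [hsy]
      exact contDiffAt_param_timeShift (S.t k) hy
    have hpair : Tendsto (fun p : (ℝ × ℝ) × ℝ => (w p, P p.1)) (𝓝 y ×ˢ 𝓝[≠] 0)
        (𝓝 (P y, P y)) :=
      (hw y hy).prodMk_nhds ((hPc y hy).tendsto.comp tendsto_fst)
    have ho := hstrict.isLittleO.comp_tendsto hpair
    have hO : (fun p : (ℝ × ℝ) × ℝ => w p - P p.1) =O[𝓝 y ×ˢ 𝓝[≠] 0] fun p => p.2 := by
      have h1 : (fun p : (ℝ × ℝ) × ℝ => S.l k (P p.1) p.2) =O[𝓝 y ×ˢ 𝓝[≠] 0]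
          fun _ => (1 : ℝ) := (hlim y hy).isBigO_one ℝ
      have h2 := (Asymptotics.isBigO_refl (fun p : (ℝ × ℝ) × ℝ => p.2) (𝓝 y ×ˢ 𝓝[≠] 0)).smul h1
      simpa [w] using h2
    have h0 := (ho.trans_isBigO hO).tendsto_inv_smul_nhds_zero
    have hmain := h0.add ((B.symm.continuous.tendsto _).comp (hlim y hy))
    rw [zero_add] at hmain
    refine hmain.congr' ?_
    filter_upwards [eventually_param_ne_zero,
      tendsto_fst.eventually (e.open_source.mem_nhds hye)] with p hp hpe
    have hsp : e.symm (P p.1) = p.1 := e.left_inv hpe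
    simp only [Function.comp_apply, hsp]
    have h3 : w p - P p.1 = p.2 • S.l k (P p.1) p.2 := by simp [w]
    rw [h3, smul_sub]
    simp only [ContinuousLinearEquiv.coe_coe, map_smul]
    rw [smul_smul, inv_mul_cancel₀ hp, one_smul, sub_add_cancel]
  · filter_upwards [hwt] with p hp
    exact e.right_inv hp

theorem t_lt_succ (S : ImpulsiveHamiltonianSystem) (k : ℤ) : S.t k < S.t (k + 1) :=
  S.t_strictMono (lt_add_one k)

theorem not_mem_range_of_mem_Ioo {k : ℤ} {τ : ℝ} (hτ : τ ∈ Ioo (S.t k) (S.t (k + 1))) :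
    τ ∉ range S.t := by
  rintro ⟨j, rfl⟩
  have h1 := S.t_strictMono.lt_iff_lt.1 hτ.1
  have h2 := S.t_strictMono.lt_iff_lt.1 hτ.2
  omega

theorem exists_mem_Ioc (S : ImpulsiveHamiltonianSystem) (τ : ℝ) :
    ∃ k, τ ∈ Ioc (S.t k) (S.t (k + 1)) := by
  obtain ⟨a, ha⟩ := (S.t_atBot.eventually (eventually_lt_atBot τ)).exists
  obtain ⟨b, hb⟩ := (S.t_atTop.eventually (eventually_ge_atTop τ)).exists
  obtain ⟨k, hk, hmax⟩ := Int.exists_greatest_of_bdd (P := fun k => S.t k < τ)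
    ⟨b, fun z hz => le_of_lt (S.t_strictMono.lt_iff_lt.1 (hz.trans_le hb))⟩ ⟨a, ha⟩
  refine ⟨k, hk, ?_⟩
  by_contra! h
  have := hmax _ h
  omega

theorem eq_of_mem_Ioc {j k : ℤ} {τ : ℝ} (hj : τ ∈ Ioc (S.t j) (S.t (j + 1)))
    (hk : τ ∈ Ioc (S.t k) (S.t (k + 1))) : j = k := by
  have h1 := S.t_strictMono.lt_iff_lt.1 (hj.1.trans_le hk.2)
  have h2 := S.t_strictMono.lt_iff_lt.1 (hk.1.trans_le hj.2)
  omega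

variable (S) in
/-- `z` solves the differential equation on the whole interval `[t_k, t_{k+1}]`; its value at `t_k`
stands for the right limit of a solution of the impulsive system. -/
def IsArc (ε : ℝ) (k : ℤ) (z : ℝ → ℝ × ℝ) : Prop :=
  ∀ t ∈ Icc (S.t k) (S.t (k + 1)),
    HasDerivWithinAt z (S.field ε t (z t)) (Icc (S.t k) (S.t (k + 1))) t

theorem IsSolution.continuousOn_Icc {ε : ℝ} {x : ℝ → ℝ × ℝ} (hx : S.IsSolution ε x) {k : ℤ} {τ : ℝ}
    (hτ : τ ∈ Ioc (S.t k) (S.t (k + 1))) : ContinuousOn x (Icc τ (S.t (k + 1))) := by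
  intro t ht
  rcases eq_or_lt_of_le ht.2 with rfl | h
  · exact (hx.left_cont (k + 1)).mono Icc_subset_Iic_self
  · exact (hx.ode t (not_mem_range_of_mem_Ioo ⟨hτ.1.trans_le ht.1, h⟩)).continuousAt
      |>.continuousWithinAt

/-- Between impulsive moments, a solution is determined by its value at any time. -/
theorem IsSolution.eq_of_mem_Ioc {ε : ℝ} (hε : ε ∈ Ioo (-S.ε₁) S.ε₁) {x : ℝ → ℝ × ℝ}
    (hx : S.IsSolution ε x) {k : ℤ} {z : ℝ → ℝ × ℝ} (hz : S.IsArc ε k z) {τ : ℝ}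
    (hτ : τ ∈ Ioc (S.t k) (S.t (k + 1))) (h : x τ = z τ) : x (S.t (k + 1)) = z (S.t (k + 1)) := by
  refine eqOn_Icc_of_hasDerivAt_Ioo (contDiff_field hε) (hx.continuousOn_Icc hτ)
    (fun t ht => hx.ode t (not_mem_range_of_mem_Ioo ⟨hτ.1.trans ht.1, ht.2⟩))
    (fun t ht => (hz t ⟨hτ.1.le.trans ht.1, ht.2⟩).continuousWithinAt.mono
      (Icc_subset_Icc_left hτ.1.le))
    (fun t ht => (hz t ⟨hτ.1.le.trans ht.1.le, ht.2.le⟩).hasDerivAt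
      (Icc_mem_nhds (hτ.1.trans ht.1) ht.2)) h ⟨hτ.2, le_rfl⟩

/-- The impulse at `t_k` and the differential equation determine the value of a solution at
`t_{k+1}` from that at `t_k`. -/
theorem IsSolution.eq_of_jump {ε : ℝ} (hε : ε ∈ Ioo (-S.ε₁) S.ε₁) {x : ℝ → ℝ × ℝ}
    (hx : S.IsSolution ε x) {k : ℤ} {z : ℝ → ℝ × ℝ} (hz : S.IsArc ε k z)
    (h : z (S.t k) = x (S.t k) + ε • S.l k (x (S.t k)) ε) :
    x (S.t (k + 1)) = z (S.t (k + 1)) := by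
  have hlt := S.t_lt_succ k
  -- The solution is continuous on the closed interval after its value at `t_k` is replaced by the
  -- right limit.
  set x' : ℝ → ℝ × ℝ := Function.update x (S.t k) (z (S.t k)) with hx'
  have hne : ∀ t, S.t k < t → x' t = x t := fun t ht => Function.update_of_ne ht.ne' _ _
  have hev : ∀ t, S.t k < t → x' =ᶠ[𝓝 t] x := fun t ht => by
    filter_upwards [Ioi_mem_nhds ht] with s hs using hne s hs
  have hc : ContinuousOn x' (Icc (S.t k) (S.t (k + 1))) := by
    intro t ht
    rcases eq_or_lt_of_le ht.1 with rfl | h'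
    · refine ContinuousWithinAt.mono ?_ Icc_subset_Ici_self
      rw [hx', ← Ioi_union_left, continuousWithinAt_union]
      refine ⟨?_, continuousWithinAt_singleton⟩
      rw [continuousWithinAt_update_same]
      simpa [h] using hx.jump k
    · have h1 := (hx.continuousOn_Icc (τ := t) ⟨h', ht.2⟩) t ⟨le_rfl, ht.2⟩
      rcases eq_or_lt_of_le ht.2 with rfl | h''
      · exact (((hx.left_cont (k + 1)).congr_of_eventuallyEq_of_mem
          ((hev _ h').filter_mono nhdsWithin_le_nhds) (mem_Iic.2 le_rfl))).mono Icc_subset_Iic_self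
      · exact ((hx.ode t (not_mem_range_of_mem_Ioo ⟨h', h''⟩)).continuousAt.congr
          (hev t h').symm).continuousWithinAt
  have := eqOn_Icc_of_hasDerivAt_Ioo (contDiff_field hε) hc
    (fun t ht => by
      rw [hne t ht.1]
      exact (hx.ode t (not_mem_range_of_mem_Ioo ht)).congr_of_eventuallyEq (hev t ht.1))
    (fun t ht => (hz t ht).continuousWithinAt)
    (fun t ht => (hz t (Ioo_subset_Icc_self ht)).hasDerivAt (Icc_mem_nhds ht.1 ht.2))
    (by simp [hx']) (⟨hlt.le, le_rfl⟩ : S.t (k + 1) ∈ Icc (S.t k) (S.t (k + 1)))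
  rw [← this, hne _ hlt]

variable (S A) in
/-- The first-order displacement in time–energy coordinates over `(t_k, t_{k+1}]`, the impulse at
`t_k` included. -/
def stepDisplacement (k : ℤ) (y : ℝ × ℝ) : ℝ × ℝ :=
  slowImpulse S A k y 0 + ∫ t in S.t k..S.t (k + 1), slowField S A t y 0

/-- The transition from `t_k` to `t_{k+1}` in time–energy coordinates, together with the arcs `Z`
that carry it out. -/
theorem exists_step (k : ℤ) {y₀ : ℝ × ℝ} (hy₀ : y₀ ∈ A.domain) :
    ∃ (W : ℝ × ℝ → ℝ → ℝ × ℝ) (Z : ℝ × ℝ → ℝ → ℝ → ℝ × ℝ),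
      IsNearIdentity W (stepDisplacement S A k) y₀ ∧
      (∀ᶠ p in 𝓝 y₀ ×ˢ 𝓝[≠] (0 : ℝ),
        S.IsArc p.2 k (fun t => A.param (timeShift t (Z p.1 p.2 t))) ∧
        A.param (timeShift (S.t k) (Z p.1 p.2 (S.t k))) = A.param (timeShift (S.t k) p.1) +
          p.2 • S.l k (A.param (timeShift (S.t k) p.1)) p.2 ∧
        Z p.1 p.2 (S.t (k + 1)) = W p.1 p.2) ∧
      ∀ t ∈ Icc (S.t k) (S.t (k + 1)),
        Tendsto (fun p : (ℝ × ℝ) × ℝ => Z p.1 p.2 t) (𝓝 y₀ ×ˢ 𝓝[≠] 0) (𝓝 y₀) := by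
  obtain ⟨J, hJ, hJp⟩ := exists_impulse_nearIdentity (S := S) k hy₀
  obtain ⟨Y, hYn, hY, hYt⟩ := exists_flow_nearIdentity A.isOpen_domain S.ε₁_pos
    (contDiffOn_slowField (S := S) (A := A)) (S.t_lt_succ k).le hy₀
  refine ⟨fun y ε => Y (J y ε) ε (S.t (k + 1)), fun y ε t => Y (J y ε) ε t, hJ.comp hYn, ?_, ?_⟩
  · filter_upwards [hJp, hJ.tendsto.eventually hY] with p h1 h2
    refine ⟨fun t ht => ?_, ?_, rfl⟩
    · exact hasDerivWithinAt_param S.H_differentiable (h2.2 t ht).2 (h2.2 t ht).1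
    · rw [h2.1, h1]
  · exact fun t ht => (hYt t ht).comp hJ.tendsto

/-- A solution passing close to the unperturbed orbit between `t_k` and `t_{k+1}` is still close to
it, in time–energy coordinates, at `t_{k+1}`. -/
theorem exists_start (k : ℤ) {y₀ : ℝ × ℝ} (hy₀ : y₀ ∈ A.domain) {u : Set (ℝ × ℝ)} (hu : u ∈ 𝓝 y₀) :
    ∀ᶠ p in 𝓝 y₀ ×ˢ 𝓝[≠] (0 : ℝ), ∀ x, S.IsSolution p.2 x → ∀ τ ∈ Ioc (S.t k) (S.t (k + 1)),
      x τ = A.param (timeShift τ p.1) →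
        ∃ y ∈ u, x (S.t (k + 1)) = A.param (timeShift (S.t (k + 1)) y) := by
  obtain ⟨C, R, hR, δ, hδ, hδε, h⟩ := exists_slow_flow A.isOpen_domain S.ε₁_pos
    (contDiffOn_slowField (S := S) (A := A)) (a := S.t k) (b := S.t (k + 1)) hy₀
  obtain ⟨r, hr, hru⟩ := Metric.nhds_basis_ball.mem_iff.1 hu
  have habs : Tendsto (fun p : (ℝ × ℝ) × ℝ => |p.2|) (𝓝 y₀ ×ˢ 𝓝[≠] 0) (𝓝 0) := by
    have := (continuous_abs.tendsto (0 : ℝ)).comp (tendsto_param_zero (l := 𝓝 y₀))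
    rwa [abs_zero] at this
  have hC : ∀ᶠ p : (ℝ × ℝ) × ℝ in 𝓝 y₀ ×ˢ 𝓝[≠] (0 : ℝ), C * |p.2| < r / 2 := by
    have := habs.const_mul C
    rw [mul_zero] at this
    exact this.eventually (gt_mem_nhds (half_pos hr))
  filter_upwards [habs.eventually (gt_mem_nhds hδ), hC,
    tendsto_fst.eventually (Metric.closedBall_mem_nhds y₀ hR),
    tendsto_fst.eventually (Metric.ball_mem_nhds y₀ (half_pos hr)),
    tendsto_snd.eventually S.eventually_mem_Ioo] with p h1 h2 h3 h4 h5 x hx τ hτ hxτ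
  obtain ⟨Y, hY, -⟩ := h p.2 h1.le τ (Ioc_subset_Icc_self hτ)
  obtain ⟨hYτ, hode⟩ := hY p.1 h3
  have hend : S.t (k + 1) ∈ Icc (S.t k) (S.t (k + 1)) := ⟨(S.t_lt_succ k).le, le_rfl⟩
  refine ⟨Y p.1 (S.t (k + 1)), hru ?_, ?_⟩
  · calc dist (Y p.1 (S.t (k + 1))) y₀
        ≤ dist (Y p.1 (S.t (k + 1))) p.1 + dist p.1 y₀ := dist_triangle _ _ _
      _ < r / 2 + r / 2 := add_lt_add (by rw [dist_eq_norm]; exact (hode _ hend).2.2.trans_lt h2) h4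
      _ = r := by ring
  · refine hx.eq_of_mem_Ioc h5 (z := fun t => A.param (timeShift t (Y p.1 t)))
      (fun t ht => ?_) hτ (by rw [hxτ, hYτ])
    exact hasDerivWithinAt_param S.H_differentiable (hode t ht).2.1 (hode t ht).1

end ImpulsiveHamiltonianSystem

/-! ### The return map and the Melnikov functions -/

/-- The composition of the `j` maps `W k, W (k + 1), …` of a parameter `ε`. -/
def iterStep {E : Type*} (W : ℤ → E → ℝ → E) (k : ℤ) : ℕ → E → ℝ → E
  | 0 => fun y _ => y
  | j + 1 => fun y ε => W (k + j) (iterStep W k j y ε) ε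

theorem isNearIdentity_iterStep {E : Type*} [NormedAddCommGroup E] [NormedSpace ℝ E]
    {W : ℤ → E → ℝ → E} {D : ℤ → E → E} {y₀ : E} (h : ∀ k, IsNearIdentity (W k) (D k) y₀)
    (k : ℤ) (j : ℕ) :
    IsNearIdentity (iterStep W k j) (fun y => ∑ i ∈ Finset.range j, D (k + i) y) y₀ := by
  induction j with
  | zero =>
    simp only [Finset.range_zero, Finset.sum_empty]
    exact IsNearIdentity.id y₀
  | succ j ih =>
    simp only [Finset.sum_range_succ]
    exact ih.comp (h (k + j))

/-- The sum of an `N`-periodic sequence over `N` consecutive indices does not depend on the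
first index. -/
theorem sum_range_add_periodic {E : Type*} [AddCommGroup E] {f : ℤ → E} {N : ℕ}
    (hf : ∀ k, f (k + N) = f k) (k : ℤ) :
    ∑ i ∈ Finset.range N, f (k + i) = ∑ i ∈ Finset.Icc (1 : ℤ) N, f i := by
  have hstep : ∀ k : ℤ, ∑ i ∈ Finset.range N, f (k + 1 + i) = ∑ i ∈ Finset.range N, f (k + i) := by
    intro k
    have h1 := Finset.sum_range_succ (fun i : ℕ => f (k + i)) N
    have h2 := Finset.sum_range_succ' (fun i : ℕ => f (k + i)) N
    rw [h1, hf] at h2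
    have h3 := add_right_cancel (h2.trans (by simp :
      _ = (∑ i ∈ Finset.range N, f (k + (i + 1 : ℕ))) + f k))
    rw [h3]
    refine Finset.sum_congr rfl fun i _ => ?_
    push_cast
    ring_nf
  have hone : ∑ i ∈ Finset.range N, f (1 + i) = ∑ i ∈ Finset.Icc (1 : ℤ) N, f i := by
    refine Finset.sum_nbij' (fun i : ℕ => (1 + i : ℤ)) (fun i => (i - 1).toNat) ?_ ?_ ?_ ?_ ?_
    · intro i hi
      simp only [Finset.mem_range, Finset.mem_Icc] at *
      omega
    · intro i hi
      simp only [Finset.mem_range, Finset.mem_Icc] at *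
      omega
    · intro i _
      simp
    · intro i hi
      simp only [Finset.mem_Icc] at hi
      omega
    · intro i _
      rfl
  rw [← hone]
  induction k using Int.induction_on with
  | zero => exact (hstep 0).symm.trans (by simp)
  | succ i ih => rw [hstep, ih]
  | pred i ih => rw [← ih, ← hstep, sub_add_cancel]

/-- Differentiation under the integral sign for a `C¹` integrand over a bounded interval. -/
theorem differentiableAt_integral {E G : Type*} [NormedAddCommGroup E] [NormedSpace ℝ E]
    [ProperSpace E] [NormedAddCommGroup G] [NormedSpace ℝ G] {F : ℝ → E → G} {U : Set E}
    (hU : IsOpen U) (hF : ContDiffOn ℝ 1 (fun z : ℝ × E => F z.1 z.2) (univ ×ˢ U))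
    (a b : ℝ) {y₀ : E} (hy₀ : y₀ ∈ U) :
    DifferentiableAt ℝ (fun y => ∫ t in a..b, F t y) y₀ := by
  have hopen : IsOpen ((univ : Set ℝ) ×ˢ U) := isOpen_univ.prod hU
  obtain ⟨r, hr, hrU⟩ := Metric.nhds_basis_closedBall.mem_iff.1 (hU.mem_nhds hy₀)
  set F' : E → ℝ → E →L[ℝ] G := fun y t =>
    (fderiv ℝ (fun z : ℝ × E => F z.1 z.2) (t, y)).comp (ContinuousLinearMap.inr ℝ ℝ E) with hF'
  have hFc : ∀ y ∈ U, Continuous fun t => F t y := fun y hy => by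
    rw [← continuousOn_univ]
    exact hF.continuousOn.comp (f := fun t => (t, y)) (by fun_prop) fun t _ => ⟨trivial, hy⟩
  have hd : ContinuousOn (fderiv ℝ (fun z : ℝ × E => F z.1 z.2)) (univ ×ˢ U) :=
    hF.continuousOn_fderiv_of_isOpen hopen le_rfl
  have hF'c : ContinuousOn (fun z : ℝ × E => F' z.2 z.1) (univ ×ˢ U) :=
    hd.clm_comp continuousOn_const
  obtain ⟨M, hM⟩ := ((isCompact_uIcc (a := a) (b := b)).prod
    (isCompact_closedBall y₀ r)).exists_bound_of_continuousOn
    (hF'c.mono (prod_mono (subset_univ _) hrU))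
  refine (intervalIntegral.hasFDerivAt_integral_of_dominated_of_fderiv_le (𝕜 := ℝ)
    (F := fun y t => F t y) (F' := F')
    (s := Metric.closedBall y₀ r) (bound := fun _ => M) (Metric.closedBall_mem_nhds y₀ hr)
    ?_ ((hFc y₀ hy₀).intervalIntegrable _ _) ?_ ?_ (by simp) ?_).differentiableAt
  · filter_upwards [hU.mem_nhds hy₀] with y hy using (hFc y hy).aestronglyMeasurable
  · have : Continuous (F' y₀) := by
      rw [← continuousOn_univ]
      exact hF'c.comp (f := fun t => (t, y₀)) (by fun_prop) fun t _ => ⟨trivial, hy₀⟩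
    exact this.aestronglyMeasurable
  · exact Eventually.of_forall fun t ht y hy => hM (t, y) ⟨uIoc_subset_uIcc ht, hy⟩
  · refine Eventually.of_forall fun t _ y hy => ?_
    have h1 := ((hF.contDiffAt (hopen.mem_nhds ⟨trivial, hrU hy⟩ :
      (univ : Set ℝ) ×ˢ U ∈ 𝓝 (t, y))).differentiableAt (by norm_num)).hasFDerivAt
    exact h1.comp y (hasFDerivAt_prodMk_right t y)

namespace ImpulsiveHamiltonianSystem

variable {S : ImpulsiveHamiltonianSystem} {A : PeriodicFamily S.H}

variable (S) in
/-- The number of impulses in the period `mT`. -/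
def numImp (m : ℕ) : ℕ := m * S.s * S.nImp

theorem T_pos (S : ImpulsiveHamiltonianSystem) : 0 < S.T := by
  have h1 : (0 : ℝ) < S.p := by exact_mod_cast S.p_pos
  exact mul_pos h1 S.T₁_pos

theorem t_add_mul (S : ImpulsiveHamiltonianSystem) (k : ℤ) (j : ℕ) :
    S.t (k + (j * S.nImp : ℕ)) = S.t k + j * S.T₂ := by
  induction j with
  | zero => simp
  | succ j ih =>
    have := S.t_periodic (k + (j * S.nImp : ℕ))
    rw [ih] at this
    push_cast at this ⊢
    rw [show k + (j + 1) * (S.nImp : ℤ) = k + j * S.nImp + S.nImp by ring]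
    linarith

theorem t_add_numImp (S : ImpulsiveHamiltonianSystem) (m : ℕ) (k : ℤ) :
    S.t (k + S.numImp m) = S.t k + m * S.T := by
  rw [numImp, t_add_mul, S.T_eq]
  push_cast
  ring

theorem l_add_numImp (S : ImpulsiveHamiltonianSystem) (m : ℕ) (k : ℤ) (x : ℝ × ℝ) {ε : ℝ}
    (hε : ε ∈ Ioo (-S.ε₁) S.ε₁) : S.l (k + S.numImp m) x ε = S.l k x ε := by
  have : ∀ j : ℕ, S.l (k + (j * S.nImp : ℕ)) x ε = S.l k x ε := by
    intro j
    induction j with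
    | zero => simp
    | succ j ih =>
      rw [← ih, ← S.l_periodic (k + (j * S.nImp : ℕ)) x ε hε]
      push_cast
      ring_nf
  exact this (m * S.s)

theorem g_add_period (S : ImpulsiveHamiltonianSystem) (m : ℕ) (τ : ℝ) (x : ℝ × ℝ) {ε : ℝ}
    (hε : ε ∈ Ioo (-S.ε₁) S.ε₁) : S.g (τ + m * S.T) x ε = S.g τ x ε := by
  have h : Function.Periodic (fun τ => S.g τ x ε) S.T₁ := fun τ => S.g_periodic τ x ε hε
  have := h.nat_mul (m * S.p) τ
  beta_reduce at this
  rw [← this, T]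
  push_cast
  ring_nf

theorem period_eq {T₀ : ℝ} {m K : ℕ} (hK : 1 ≤ K) (hres : T₀ / S.T = (m : ℝ) / K) :
    (m : ℝ) * S.T = K * T₀ := by
  have h1 : (K : ℝ) ≠ 0 := by exact_mod_cast (Nat.one_le_iff_ne_zero.mp hK)
  have h2 := S.T_pos.ne'
  field_simp at hres
  linarith

theorem slowField_add_period {T₀ : ℝ} {m K : ℕ} (hiso : ∀ h ∈ A.V, A.per h = T₀)
    (hmT : (m : ℝ) * S.T = K * T₀) {y : ℝ × ℝ} (hy : y ∈ A.domain) (t : ℝ) :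
    slowField S A (t + m * S.T) y 0 = slowField S A t y 0 := by
  rw [slowField, slowField, S.g_add_period m t _ S.zero_mem_Ioo, hmT,
    param_timeShift_add_period hy hiso, slow_timeShift_add_period hy hiso]

theorem slowImpulse_add_numImp {T₀ : ℝ} {m K : ℕ} (hiso : ∀ h ∈ A.V, A.per h = T₀)
    (hmT : (m : ℝ) * S.T = K * T₀) {y : ℝ × ℝ} (hy : y ∈ A.domain) (k : ℤ) :
    slowImpulse S A (k + S.numImp m) y 0 = slowImpulse S A k y 0 := by
  rw [slowImpulse, slowImpulse, S.l_add_numImp m k _ S.zero_mem_Ioo, t_add_numImp, hmT,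
    param_timeShift_add_period hy hiso, slow_timeShift_add_period hy hiso]

theorem contDiffOn_slowField_zero :
    ContDiffOn ℝ 1 (fun z : ℝ × (ℝ × ℝ) => slowField S A z.1 z.2 0) (univ ×ˢ A.domain) :=
  contDiffOn_slowField.comp (f := fun z : ℝ × (ℝ × ℝ) => (z.1, z.2, (0 : ℝ))) (by fun_prop)
    fun _ hz => ⟨trivial, hz.2, S.zero_mem_Ioo⟩

theorem continuous_slowField_zero {y : ℝ × ℝ} (hy : y ∈ A.domain) :
    Continuous fun t => slowField S A t y 0 := by
  rw [← continuousOn_univ]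
  exact contDiffOn_slowField_zero.continuousOn.comp (f := fun t => (t, y)) (by fun_prop)
    fun t _ => ⟨trivial, hy⟩

theorem differentiableAt_stepDisplacement (k : ℤ) {y : ℝ × ℝ} (hy : y ∈ A.domain) :
    DifferentiableAt ℝ (stepDisplacement S A k) y := by
  refine DifferentiableAt.add ?_
    (differentiableAt_integral A.isOpen_domain contDiffOn_slowField_zero _ _ hy)
  have hc : ContDiffOn ℝ 1 (timeShift (S.t k)) A.domain :=
    (contDiff_timeShift.comp (f := fun y : ℝ × ℝ => (S.t k, y)) (by fun_prop)).contDiffOn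
  have hm : MapsTo (timeShift (S.t k)) A.domain A.domain := fun z hz => timeShift_mem_domain hz
  have h : ContDiffOn ℝ 1 (fun y => slowImpulse S A k y 0) A.domain := by
    refine contDiffOn_slow S.H_smooth hc hm ?_
    exact ((S.l_smooth k 0 S.zero_mem_Ioo).of_le (by norm_num)).comp_contDiffOn
      ((contDiffOn_param.of_le (by norm_num)).comp hc hm)
  exact (h.contDiffAt (A.isOpen_domain.mem_nhds hy)).differentiableAt (by norm_num)

/-- The displacement over the period `mT` does not depend on the impulsive moment at which the
period starts, and its components are the two Melnikov functions. -/
theorem sum_stepDisplacement {T₀ : ℝ} {m K : ℕ} (hiso : ∀ h ∈ A.V, A.per h = T₀)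
    (hmT : (m : ℝ) * S.T = K * T₀) (k : ℤ) {τ r : ℝ} (hr : r ∈ A.V) :
    A.Ω r * (∑ i ∈ Finset.range (S.numImp m), stepDisplacement S A (k + i) (-τ, r)).1
        = melnikovN S A m τ r ∧
      (∑ i ∈ Finset.range (S.numImp m), stepDisplacement S A (k + i) (-τ, r)).2
        = melnikovM S A m τ r := by
  have hy : ((-τ, r) : ℝ × ℝ) ∈ A.domain := ⟨trivial, hr⟩
  have hcont := continuous_slowField_zero (S := S) hy
  have hint : ∀ a b, IntervalIntegrable (fun t => slowField S A t (-τ, r) 0)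
      MeasureTheory.volume a b := fun a b => hcont.intervalIntegrable a b
  have hsum : ∑ i ∈ Finset.range (S.numImp m), stepDisplacement S A (k + i) (-τ, r)
      = (∫ t in τ..(τ + m * S.T), slowField S A t (-τ, r) 0)
        + ∑ i ∈ Finset.Icc (1 : ℤ) (S.numImp m), slowImpulse S A i (-τ, r) 0 := by
    simp only [stepDisplacement, Finset.sum_add_distrib]
    rw [sum_range_add_periodic (f := fun k => slowImpulse S A k (-τ, r) 0)
      (slowImpulse_add_numImp hiso hmT hy) k, add_comm]
    congr 1
    have h1 := intervalIntegral.sum_integral_adjacent_intervals (n := S.numImp m)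
      (a := fun i : ℕ => S.t (k + i)) (fun i _ => hint _ _)
    have h2 : Function.Periodic (fun t => slowField S A t (-τ, r) 0) (m * S.T) :=
      slowField_add_period hiso hmT hy
    simp only [Nat.cast_zero, add_zero, t_add_numImp] at h1
    rw [h2.intervalIntegral_add_eq τ (S.t k), ← h1]
    refine Finset.sum_congr rfl fun i _ => ?_
    push_cast
    rw [add_assoc]
  have hshift : ∀ t, timeShift t (-τ, r) = (t - τ, r) := fun t => by
    simp [timeShift, sub_eq_add_neg]
  have hcast : ((S.numImp m : ℕ) : ℤ) = m * S.s * S.nImp := by simp [numImp]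
  rw [hsum, hcast]
  constructor
  · rw [Prod.fst_add, Prod.fst_sum, mul_add, Finset.mul_sum, melnikovN]
    congr 1
    · rw [← ContinuousLinearMap.coe_fst' (R := ℝ) (M₁ := ℝ) (M₂ := ℝ),
        ← (ContinuousLinearMap.fst ℝ ℝ ℝ).intervalIntegral_comp_comm (hint _ _),
        ← intervalIntegral.integral_const_mul]
      refine intervalIntegral.integral_congr fun t _ => ?_
      simp only [ContinuousLinearMap.coe_fst', slowField, hshift]
      rw [rowMul_α S.H_differentiable hiso hr]
      rfl
    · refine Finset.sum_congr rfl fun i _ => ?_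
      simp only [slowImpulse, hshift]
      rw [rowMul_α S.H_differentiable hiso hr]
      rfl
  · rw [Prod.snd_add, Prod.snd_sum, melnikovM]
    congr 1
    rw [← ContinuousLinearMap.coe_snd' (R := ℝ) (M₁ := ℝ) (M₂ := ℝ),
      ← (ContinuousLinearMap.snd ℝ ℝ ℝ).intervalIntegral_comp_comm (hint _ _)]
    refine intervalIntegral.integral_congr fun t _ => ?_
    simp only [ContinuousLinearMap.coe_snd', slowField, hshift, slow_apply, param]

/-! ### Necessity of the Melnikov conditions -/

theorem numImp_pos (S : ImpulsiveHamiltonianSystem) {m : ℕ} (hm : 1 ≤ m) : 0 < S.numImp m :=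
  Nat.mul_pos (Nat.mul_pos hm S.s_pos) S.nImp_pos

/-- Where the displacement over a period does not vanish, no periodic solution passes at the
moment `t_k`: its return map would have a fixed point. -/
theorem eventually_no_subharmonic_at_t {T₀ : ℝ} {m K : ℕ} (hiso : ∀ h ∈ A.V, A.per h = T₀)
    (hmT : (m : ℝ) * S.T = K * T₀) {y₀ : ℝ × ℝ} (hy₀ : y₀ ∈ A.domain) (k : ℤ)
    (hD : ∑ i ∈ Finset.range (S.numImp m), stepDisplacement S A (k + i) y₀ ≠ 0) :
    ∀ᶠ p in 𝓝 y₀ ×ˢ 𝓝[≠] (0 : ℝ), ∀ x, S.IsSubharmonic m p.2 x →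
      x (S.t k) ≠ A.param (timeShift (S.t k) p.1) := by
  choose W Z hW hZ _ using fun k => exists_step (S := S) (A := A) k hy₀
  have hR := fun j => isNearIdentity_iterStep hW k j
  have hstep : ∀ j : ℕ, ∀ᶠ p in 𝓝 y₀ ×ˢ 𝓝[≠] (0 : ℝ), ∀ x, S.IsSolution p.2 x →
      x (S.t k) = A.param (timeShift (S.t k) p.1) →
      x (S.t (k + j)) = A.param (timeShift (S.t (k + j)) (iterStep W k j p.1 p.2)) := by
    intro j
    induction j with
    | zero => exact Eventually.of_forall fun p x _ h => by simpa [iterStep] using h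
    | succ j ih =>
      filter_upwards [ih, (hR j).tendsto.eventually (hZ (k + j)),
        tendsto_snd.eventually S.eventually_mem_Ioo] with p h1 h2 h3 x hx hxk
      have h4 := h1 x hx hxk
      have h5 := hx.eq_of_jump h3 h2.1 (by rw [h2.2.1, h4])
      rw [h2.2.2] at h5
      have hcast : k + ((j + 1 : ℕ) : ℤ) = k + j + 1 := by push_cast; ring
      rw [hcast, h5]
      rfl
  obtain ⟨u, hu, hinj⟩ := eventually_param_injective (A := A) (S := S) (S.t k) hy₀
  have hRN := hR (S.numImp m)
  filter_upwards [hstep (S.numImp m), tendsto_fst.eventually hu,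
    hRN.tendsto.eventually (tendsto_fst.eventually hu),
    hRN.tendsto.eventually (tendsto_fst.eventually (A.isOpen_domain.mem_nhds hy₀)),
    hRN.2.self_of_nhds.eventually (isOpen_ne.mem_nhds hD)] with p h1 h2 h3 h4 h5 x hx hxk
  have h6 := h1 x hx.1 hxk
  rw [t_add_numImp, hx.2, hmT, param_timeShift_add_period h4 hiso, hxk] at h6
  refine h5 ?_
  rw [← hinj h2 h3 h6, sub_self, smul_zero]

/-- The same at any time of a period: the solution is followed to the next impulsive moment, where
it is still close to the same unperturbed orbit. -/
theorem eventually_no_subharmonic {T₀ : ℝ} {m K : ℕ} (hiso : ∀ h ∈ A.V, A.per h = T₀)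
    (hmT : (m : ℝ) * S.T = K * T₀) {y₀ : ℝ × ℝ} (hy₀ : y₀ ∈ A.domain)
    (hD : ∀ k : ℤ, ∑ i ∈ Finset.range (S.numImp m), stepDisplacement S A (k + i) y₀ ≠ 0) :
    ∀ᶠ p in 𝓝 y₀ ×ˢ 𝓝[≠] (0 : ℝ), ∀ x, S.IsSubharmonic m p.2 x →
      ∀ τ ∈ Ioc (S.t 0) (S.t 0 + m * S.T), x τ ≠ A.param (timeShift τ p.1) := by
  have hk : ∀ k : ℤ, ∀ᶠ p in 𝓝 y₀ ×ˢ 𝓝[≠] (0 : ℝ), ∀ x, S.IsSubharmonic m p.2 x →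
      ∀ τ ∈ Ioc (S.t k) (S.t (k + 1)), x τ ≠ A.param (timeShift τ p.1) := by
    intro k
    obtain ⟨P, hP, Q, hQ, hPQ⟩ := eventually_prod_iff.1
      (eventually_no_subharmonic_at_t hiso hmT hy₀ (k + 1) (hD (k + 1)))
    filter_upwards [exists_start (S := S) k hy₀ hP, tendsto_snd.eventually hQ]
      with p h1 h2 x hx τ hτ hxτ
    obtain ⟨y, hy, hxy⟩ := h1 x hx.1 τ hτ hxτ
    exact hPQ hy h2 x hx hxy
  have hall : ∀ᶠ p in 𝓝 y₀ ×ˢ 𝓝[≠] (0 : ℝ), ∀ k ∈ Finset.Ico (0 : ℤ) (S.numImp m), ∀ x,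
      S.IsSubharmonic m p.2 x →
      ∀ τ ∈ Ioc (S.t k) (S.t (k + 1)), x τ ≠ A.param (timeShift τ p.1) :=
    (Finset.eventually_all _).2 fun k _ => hk k
  filter_upwards [hall] with p hp x hx τ hτ
  obtain ⟨k, hτk⟩ := S.exists_mem_Ioc τ
  rw [← t_add_numImp, zero_add] at hτ
  have h1 := S.t_strictMono.lt_iff_lt.1 (hτ.1.trans_le hτk.2)
  have h2 := S.t_strictMono.lt_iff_lt.1 (hτk.1.trans_le hτ.2)
  exact hp k (Finset.mem_Ico.2 ⟨by omega, h2⟩) x hx τ hτk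

/-- For small `ε`, a periodic solution that meets the closed orbits with energies in a compact set
forces a common zero of the Melnikov functions. -/
theorem exists_melnikov_zero_of_subharmonic {T₀ : ℝ} {m K : ℕ} (hm : 1 ≤ m) (hT₀ : 0 < T₀)
    (hiso : ∀ h ∈ A.V, A.per h = T₀) (hmT : (m : ℝ) * S.T = K * T₀)
    {C : Set ℝ} (hC : IsCompact C) (hCV : C ⊆ A.V) :
    ∀ᶠ ε in 𝓝[≠] (0 : ℝ), (∃ x : ℝ → ℝ × ℝ, S.IsSubharmonic m ε x ∧
        ∃ τ σ : ℝ, ∃ h ∈ C, x τ = A.q σ h) →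
      ∃ t₀ ∈ Icc 0 T₀, ∃ h₀ ∈ C, melnikovM S A m t₀ h₀ = 0 ∧ melnikovN S A m t₀ h₀ = 0 := by
  by_cases hz : ∃ t₀ ∈ Icc 0 T₀, ∃ h₀ ∈ C, melnikovM S A m t₀ h₀ = 0 ∧ melnikovN S A m t₀ h₀ = 0
  · exact Eventually.of_forall fun _ _ => hz
  have hcompact : IsCompact (Icc (-T₀) 0 ×ˢ C) := isCompact_Icc.prod hC
  have hev : ∀ᶠ p in 𝓝ˢ (Icc (-T₀) 0 ×ˢ C) ×ˢ 𝓝[≠] (0 : ℝ), ∀ x, S.IsSubharmonic m p.2 x →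
      ∀ τ ∈ Ioc (S.t 0) (S.t 0 + m * S.T), x τ ≠ A.param (timeShift τ p.1) := by
    refine hcompact.mem_nhdsSet_prod_of_forall fun y hy => ?_
    refine eventually_no_subharmonic hiso hmT ⟨trivial, hCV hy.2⟩ fun k h0 => hz ?_
    have h1 := sum_stepDisplacement hiso hmT k (τ := -y.1) (hCV hy.2)
    rw [neg_neg, Prod.mk.eta, h0] at h1
    simp only [Prod.fst_zero, Prod.snd_zero, mul_zero] at h1
    exact ⟨-y.1, ⟨by linarith [hy.1.2], by linarith [hy.1.1]⟩, y.2, hy.2, h1.2.symm, h1.1.symm⟩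
  obtain ⟨P, hP, Q, hQ, hPQ⟩ := eventually_prod_iff.1 hev
  filter_upwards [hQ] with ε hε
  rintro ⟨x, hx, τ, σ, h, hh, hxτ⟩
  have hpos : 0 < (m : ℝ) * S.T := mul_pos (by exact_mod_cast hm) S.T_pos
  -- The time is moved into one period of the impulses, the phase into `[-T₀, 0]`.
  obtain ⟨j, hj, -⟩ := existsUnique_add_zsmul_mem_Ioc hpos τ (S.t 0)
  obtain ⟨i, hi, -⟩ := existsUnique_add_zsmul_mem_Ioc hT₀ (σ - (τ + j • ((m : ℝ) * S.T))) (-T₀)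
  have hy : ((σ - (τ + j • ((m : ℝ) * S.T)) + i • T₀, h) : ℝ × ℝ) ∈ Icc (-T₀) 0 ×ˢ C :=
    ⟨⟨hi.1.le, by linarith [hi.2]⟩, hh⟩
  refine absurd ?_ (hPQ (hP.self_of_nhdsSet _ hy) hε x hx _ hj)
  rw [(hx.2.zsmul j) τ, hxτ]
  have hq : Function.Periodic (fun τ => A.q τ h) T₀ := hiso h (hCV hh) ▸ A.q_periodic h (hCV hh)
  have := hq.zsmul i σ
  beta_reduce at this
  rw [← this, param, timeShift]
  congr 1
  ring

/-! ### Periodic solutions from zeros of the Melnikov functions -/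

/-- The index `k` with `τ ∈ (t_k, t_{k+1}]`. -/
def arcIndex (S : ImpulsiveHamiltonianSystem) (τ : ℝ) : ℤ := (S.exists_mem_Ioc τ).choose

theorem mem_Ioc_arcIndex (S : ImpulsiveHamiltonianSystem) (τ : ℝ) :
    τ ∈ Ioc (S.t (S.arcIndex τ)) (S.t (S.arcIndex τ + 1)) := (S.exists_mem_Ioc τ).choose_spec

theorem arcIndex_eq {k : ℤ} {τ : ℝ} (hτ : τ ∈ Ioc (S.t k) (S.t (k + 1))) : S.arcIndex τ = k :=
  S.eq_of_mem_Ioc (S.mem_Ioc_arcIndex τ) hτ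

/-- Arcs that match at the impulsive moments form a solution of the impulsive system. -/
theorem isSolution_of_arcs {ε : ℝ} {z : ℤ → ℝ → ℝ × ℝ} (hz : ∀ k, S.IsArc ε k (z k))
    (hj : ∀ k, z k (S.t k) =
      z (k - 1) (S.t k) + ε • S.l k (z (k - 1) (S.t k)) ε) :
    S.IsSolution ε (fun τ => z (S.arcIndex τ) τ) := by
  have hval : ∀ k, z (S.arcIndex (S.t k)) (S.t k) = z (k - 1) (S.t k) := fun k => by
    rw [arcIndex_eq (k := k - 1)]
    have := S.t_lt_succ (k - 1)
    rw [sub_add_cancel] at *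
    exact ⟨this, le_rfl⟩
  refine ⟨fun τ hτ => ?_, fun k => ?_, fun k => ?_⟩
  · have hmem := S.mem_Ioc_arcIndex τ
    have hlt : τ < S.t (S.arcIndex τ + 1) := lt_of_le_of_ne hmem.2 fun h => hτ ⟨_, h.symm⟩
    have h1 := (hz (S.arcIndex τ) τ ⟨hmem.1.le, hmem.2⟩).hasDerivAt (Icc_mem_nhds hmem.1 hlt)
    refine h1.congr_of_eventuallyEq ?_
    filter_upwards [Ioo_mem_nhds hmem.1 hlt] with s hs
    rw [arcIndex_eq (k := S.arcIndex τ) ⟨hs.1, hs.2.le⟩]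
  · have hlt := S.t_lt_succ (k - 1)
    have h1 := (hz (k - 1) (S.t (k - 1 + 1)) ⟨hlt.le, le_rfl⟩).continuousWithinAt
    rw [sub_add_cancel] at hlt h1
    have h2 : ContinuousWithinAt (z (k - 1)) (Iic (S.t k)) (S.t k) :=
      h1.mono_of_mem_nhdsWithin (Icc_mem_nhdsLE hlt)
    refine h2.congr_of_eventuallyEq ?_ (hval k)
    filter_upwards [Ioc_mem_nhdsLE hlt] with s hs
    rw [arcIndex_eq (k := k - 1) (by rwa [sub_add_cancel])]
  · have hlt := S.t_lt_succ k
    have h1 := (hz k (S.t k) ⟨le_rfl, hlt.le⟩).continuousWithinAt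
    have h2 : Tendsto (z k) (𝓝[>] (S.t k)) (𝓝 (z k (S.t k))) :=
      h1.mono_of_mem_nhdsWithin (Icc_mem_nhdsGT hlt)
    simp only [hval k, ← hj k]
    refine h2.congr' ?_
    filter_upwards [Ioc_mem_nhdsGT hlt] with s hs
    rw [arcIndex_eq hs]

theorem t_add_int_mul (S : ImpulsiveHamiltonianSystem) (m : ℕ) (k j : ℤ) :
    S.t (k + j * S.numImp m) = S.t k + j * (m * S.T) := by
  induction j using Int.induction_on with
  | zero => simp
  | succ i ih =>
    rw [add_mul, ← add_assoc, one_mul, t_add_numImp, ih]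
    push_cast
    ring
  | pred i ih =>
    have := S.t_add_numImp m (k + (-(i : ℤ) - 1) * S.numImp m)
    rw [show k + (-(i : ℤ) - 1) * S.numImp m + S.numImp m = k + -(i : ℤ) * S.numImp m by ring,
      ih] at this
    push_cast at this ⊢
    linarith

theorem field_add_int_mul (m : ℕ) {ε : ℝ} (hε : ε ∈ Ioo (-S.ε₁) S.ε₁) (t : ℝ) (x : ℝ × ℝ) (j : ℤ) :
    S.field ε (t + j * (m * S.T)) x = S.field ε t x := by
  have h : Function.Periodic (fun t => S.field ε t x) (m * S.T) := fun t => by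
    simp only [field, S.g_add_period m t x hε]
  exact h.int_mul j t

theorem IsArc.translate {m : ℕ} {ε : ℝ} (hε : ε ∈ Ioo (-S.ε₁) S.ε₁) {k : ℤ} {z : ℝ → ℝ × ℝ}
    (hz : S.IsArc ε k z) (j : ℤ) :
    S.IsArc ε (k + j * S.numImp m) (fun t => z (t - j * (m * S.T))) := by
  intro t ht
  have hk : k + j * S.numImp m + 1 = k + 1 + j * S.numImp m := by ring
  rw [hk, t_add_int_mul, t_add_int_mul] at ht ⊢
  have ht' : t - j * (m * S.T) ∈ Icc (S.t k) (S.t (k + 1)) :=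
    ⟨by linarith [ht.1], by linarith [ht.2]⟩
  have hmaps : MapsTo (fun s => s - j * (m * S.T))
      (Icc (S.t k + j * (m * S.T)) (S.t (k + 1) + j * (m * S.T)))
      (Icc (S.t k) (S.t (k + 1))) := fun s hs => ⟨by linarith [hs.1], by linarith [hs.2]⟩
  have h1 := HasDerivWithinAt.scomp (h := fun s => s - j * (m * S.T)) t (hz _ ht')
    ((hasDerivWithinAt_id t _).sub_const (j * (m * S.T))) hmaps
  rw [one_smul] at h1
  have h2 := field_add_int_mul (S := S) m hε (t - j * (m * S.T)) (z (t - j * (m * S.T))) j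
  rw [sub_add_cancel] at h2
  simp only [h2]
  exact h1

/-- Matching arcs over one period, whose end point is the starting point, extend to a periodic
solution. Here `v i` is the value at `t_i`, the impulse not being applied yet. -/
theorem isSubharmonic_of_arcs {m : ℕ} (hm : 1 ≤ m) {ε : ℝ} (hε : ε ∈ Ioo (-S.ε₁) S.ε₁)
    {z : ℕ → ℝ → ℝ × ℝ} {v : ℕ → ℝ × ℝ} (hz : ∀ i < S.numImp m, S.IsArc ε i (z i))
    (hstart : ∀ i < S.numImp m, z i (S.t i) = v i + ε • S.l i (v i) ε)
    (hend : ∀ i < S.numImp m, z i (S.t (i + 1)) = v (i + 1)) (hv : v (S.numImp m) = v 0) :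
    S.IsSubharmonic m ε (fun τ => z (S.arcIndex τ % S.numImp m).toNat
      (τ - (S.arcIndex τ / S.numImp m : ℤ) * (m * S.T))) := by
  have hN : (0 : ℤ) < S.numImp m := by exact_mod_cast S.numImp_pos hm
  have hNm := hN.ne'
  have hmod : ∀ k : ℤ, ∃ i : ℕ, i < S.numImp m ∧ k % S.numImp m = i := fun k =>
    ⟨(k % S.numImp m).toNat, by
      have := Int.emod_lt_of_pos k hN
      omega, by
      rw [Int.toNat_of_nonneg (Int.emod_nonneg _ hNm)]⟩
  have hl : ∀ (i j : ℤ) (x : ℝ × ℝ), S.l (i + j * S.numImp m) x ε = S.l i x ε := fun i j x =>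
    (show Function.Periodic (fun k => S.l k x ε) (S.numImp m : ℤ) from
      fun k => S.l_add_numImp m k x hε).int_mul j i
  refine ⟨isSolution_of_arcs
    (z := fun k τ => z (k % S.numImp m).toNat (τ - (k / S.numImp m : ℤ) * (m * S.T))) ?_ ?_, ?_⟩
  · intro k
    obtain ⟨i, hi, hki⟩ := hmod k
    have h1 := (hz i hi).translate (m := m) hε (k / S.numImp m)
    rw [← hki, Int.emod_add_ediv_mul] at h1
    simpa only [hki, Int.toNat_natCast] using h1
  · intro k
    obtain ⟨i, hi, hki⟩ := hmod (k - 1)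
    have hkk : k - 1 = i + (k - 1) / S.numImp m * S.numImp m := by
      rw [← hki, Int.emod_add_ediv_mul]
    set j := (k - 1) / (S.numImp m : ℤ) with hjdef
    have hk : k = i + 1 + j * S.numImp m := by omega
    have htk : S.t k = S.t (i + 1) + j * (m * S.T) := by
      conv_lhs => rw [hk]
      exact S.t_add_int_mul m _ j
    have hprev : z ((k - 1) % S.numImp m).toNat (S.t k - j * (m * S.T)) = v (i + 1) := by
      rw [hki, Int.toNat_natCast, htk, add_sub_cancel_right, hend i hi]
    have hlk : ∀ x, S.l k x ε = S.l (i + 1) x ε := fun x => by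
      conv_lhs => rw [hk]
      exact hl _ j x
    simp only [hprev, hlk]
    -- Either `t_{k-1}` and `t_k` lie in the same period, or `t_k` begins the next one.
    rcases Nat.lt_or_ge (i + 1) (S.numImp m) with h | h
    · have h1 : k % S.numImp m = ((i + 1 : ℕ) : ℤ) := by
        rw [hk, Int.add_mul_emod_self_right]
        exact Int.emod_eq_of_lt (by positivity) (by exact_mod_cast h)
      have h2 : k / S.numImp m = j := by
        rw [hk, Int.add_mul_ediv_right _ _ hNm, Int.ediv_eq_zero_of_lt (by positivity)
          (by exact_mod_cast h), zero_add]
      rw [h1, h2, Int.toNat_natCast, htk, add_sub_cancel_right]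
      have := hstart (i + 1) h
      push_cast at this
      exact this
    · have hiN : ((i : ℤ) + 1) = S.numImp m := by omega
      have hiN' : i + 1 = S.numImp m := by omega
      have hk' : k = 0 + (j + 1) * S.numImp m := by rw [hk, hiN]; ring
      have h1 : k % S.numImp m = 0 := by rw [hk', Int.add_mul_emod_self_right, Int.zero_emod]
      have h2 : k / S.numImp m = j + 1 := by
        rw [hk', Int.add_mul_ediv_right _ _ hNm, Int.zero_ediv, zero_add]
      have h3 : S.t k = S.t 0 + ((j + 1 : ℤ) : ℝ) * (m * S.T) := by
        conv_lhs => rw [hk']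
        exact S.t_add_int_mul m _ _
      rw [h1, h2, h3, add_sub_cancel_right, hiN', hv, hiN]
      have h4 := hstart 0 (S.numImp_pos hm)
      have h5 := hl 0 1 (v 0)
      rw [zero_add, one_mul] at h5
      rw [h5]
      exact_mod_cast h4
  · intro τ
    have h1 : S.arcIndex (τ + m * S.T) = S.arcIndex τ + S.numImp m := by
      have h2 := S.mem_Ioc_arcIndex τ
      refine arcIndex_eq ⟨?_, ?_⟩
      · rw [t_add_numImp]; linarith [h2.1]
      · rw [add_right_comm, t_add_numImp]; linarith [h2.2]
    simp only [h1]
    rw [Int.add_emod_right, Int.add_ediv_of_dvd_right (dvd_refl _), Int.ediv_self hNm]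
    push_cast
    ring_nf

/-- A nondegenerate zero `y₀` of the displacement over a period gives periodic solutions that
converge to the unperturbed motion through `y₀`. -/
theorem exists_subharmonic_of_zeros {T₀ : ℝ} {m K : ℕ} (hm : 1 ≤ m)
    (hiso : ∀ h ∈ A.V, A.per h = T₀) (hmT : (m : ℝ) * S.T = K * T₀) {y₀ : ℝ × ℝ}
    (hy₀ : y₀ ∈ A.domain) {B : (ℝ × ℝ) ≃L[ℝ] (ℝ × ℝ)}
    (hB : HasFDerivAt (fun y => ∑ i ∈ Finset.range (S.numImp m), stepDisplacement S A (0 + i) y)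
      (B : ℝ × ℝ →L[ℝ] ℝ × ℝ) y₀)
    (h0 : ∑ i ∈ Finset.range (S.numImp m), stepDisplacement S A (0 + i) y₀ = 0) :
    ∃ x : ℝ → ℝ → ℝ × ℝ, (∀ᶠ ε in 𝓝[≠] (0 : ℝ), S.IsSubharmonic m ε (x ε)) ∧
      ∀ τ, Tendsto (fun ε => x ε τ) (𝓝[≠] 0) (𝓝 (A.param (timeShift τ y₀))) := by
  choose W Z hW hZ hZt using fun k => exists_step (S := S) (A := A) k hy₀
  have hR := fun j => isNearIdentity_iterStep hW 0 j
  have hRN := hR (S.numImp m)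
  obtain ⟨Y, hYz, hY⟩ := exists_zeros_tendsto
    (E := fun y ε => ε⁻¹ • (iterStep W 0 (S.numImp m) y ε - y)) hB h0
    (by
      filter_upwards [A.isOpen_domain.mem_nhds hy₀] with y hy
      exact (DifferentiableAt.fun_sum (u := Finset.range (S.numImp m)) fun (i : ℕ) _ =>
        differentiableAt_stepDisplacement (S := S) (0 + (i : ℤ)) hy).continuousAt)
    (by
      filter_upwards [hRN.1] with p hp
      exact (hp.sub continuousAt_id).const_smul p.2⁻¹)
    hRN.2
  have hpair : Tendsto (fun ε => (Y ε, ε)) (𝓝[≠] 0) (𝓝 y₀ ×ˢ 𝓝[≠] 0) := hY.prodMk tendsto_id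
  let w : ℕ → ℝ → ℝ × ℝ := fun i ε => iterStep W 0 i (Y ε) ε
  have hw : ∀ i, Tendsto (fun ε => (w i ε, ε)) (𝓝[≠] 0) (𝓝 y₀ ×ˢ 𝓝[≠] 0) := fun i =>
    (hR i).tendsto.comp hpair
  have hw1 : ∀ i, Tendsto (w i) (𝓝[≠] 0) (𝓝 y₀) := fun i => tendsto_fst.comp (hw i)
  let z : ℝ → ℕ → ℝ → ℝ × ℝ := fun ε i t => A.param (timeShift t (Z i (w i ε) ε t))
  have hfix : ∀ᶠ ε in 𝓝[≠] (0 : ℝ), w (S.numImp m) ε = w 0 ε := by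
    filter_upwards [hYz, eventually_mem_nhdsWithin] with ε h1 h2
    exact sub_eq_zero.1 ((smul_eq_zero.1 h1).resolve_left (inv_ne_zero h2))
  have hall : ∀ᶠ ε in 𝓝[≠] (0 : ℝ), ∀ i ∈ Finset.range (S.numImp m), _ :=
    (Finset.eventually_all _).2 fun (i : ℕ) _ => (hw i).eventually (hZ i)
  refine ⟨fun ε τ => z ε (S.arcIndex τ % S.numImp m).toNat
      (τ - (S.arcIndex τ / S.numImp m : ℤ) * (m * S.T)), ?_, ?_⟩
  · filter_upwards [hall, hfix, S.eventually_mem_Ioo,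
      (hw1 0).eventually (A.isOpen_domain.mem_nhds hy₀)] with ε h1 h2 h3 h4
    refine isSubharmonic_of_arcs hm h3 (z := z ε)
      (v := fun i => A.param (timeShift (S.t i) (w i ε)))
      (fun i hi => (h1 i (Finset.mem_range.2 hi)).1)
      (fun i hi => (h1 i (Finset.mem_range.2 hi)).2.1)
      (fun i hi => ?_) ?_
    · have := (h1 i (Finset.mem_range.2 hi)).2.2
      simp only [z]
      rw [this]
      simp [w, iterStep]
    · have h5 := S.t_add_numImp m 0
      rw [zero_add] at h5
      simp only [h2, h5, hmT, Nat.cast_zero]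
      exact param_timeShift_add_period h4 hiso K
  · intro τ
    set k := S.arcIndex τ
    have hN : (0 : ℤ) < S.numImp m := by exact_mod_cast S.numImp_pos hm
    have hi : ((k % S.numImp m).toNat : ℤ) = k % S.numImp m :=
      Int.toNat_of_nonneg (Int.emod_nonneg _ hN.ne')
    set i := (k % S.numImp m).toNat
    set j := k / (S.numImp m : ℤ)
    have hk : k = i + j * S.numImp m := by rw [hi, Int.emod_add_ediv_mul]
    have hmem : τ - j * (m * S.T) ∈ Icc (S.t i) (S.t (i + 1)) := by
      have h1 : τ ∈ Ioc (S.t k) (S.t (k + 1)) := S.mem_Ioc_arcIndex τ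
      rw [hk, add_right_comm, t_add_int_mul, t_add_int_mul] at h1
      exact ⟨by linarith [h1.1], by linarith [h1.2]⟩
    have h2 := (hZt i _ hmem).comp (hw i)
    have h3 : Tendsto (fun ε => z ε i (τ - j * (m * S.T))) (𝓝[≠] 0)
        (𝓝 (A.param (timeShift (τ - j * (m * S.T)) y₀))) :=
      (contDiffAt_param_timeShift (S := S) (τ - j * (m * S.T)) hy₀).continuousAt.tendsto.comp h2
    have h4 : A.param (timeShift (τ - j * (m * S.T)) y₀) = A.param (timeShift τ y₀) := by
      have hper : Function.Periodic (fun t => A.param (timeShift t y₀)) (m * S.T) := fun t => by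
        simp only [hmT, param_timeShift_add_period hy₀ hiso]
      exact hper.sub_int_mul_eq j
    rwa [h4] at h3

/-- The Jacobian of the Melnikov functions is, up to sign and the frequency, that of the
displacement over a period. -/
theorem exists_equiv_of_jacobian {T₀ : ℝ} {m K : ℕ} (hiso : ∀ h ∈ A.V, A.per h = T₀)
    (hmT : (m : ℝ) * S.T = K * T₀) {t₀ h₀ : ℝ} (hh₀ : h₀ ∈ A.V)
    (hJ : Matrix.det !![deriv (fun τ => melnikovM S A m τ h₀) t₀,
                      deriv (fun r => melnikovM S A m t₀ r) h₀;
                    deriv (fun τ => melnikovN S A m τ h₀) t₀,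
                      deriv (fun r => melnikovN S A m t₀ r) h₀] ≠ 0) :
    ∃ B : (ℝ × ℝ) ≃L[ℝ] (ℝ × ℝ),
      HasFDerivAt (fun y => ∑ i ∈ Finset.range (S.numImp m), stepDisplacement S A (0 + i) y)
      (B : ℝ × ℝ →L[ℝ] ℝ × ℝ) (-t₀, h₀) := by
  have hy₀ : ((-t₀, h₀) : ℝ × ℝ) ∈ A.domain := ⟨trivial, hh₀⟩
  set D : ℝ × ℝ → ℝ × ℝ :=
    fun y => ∑ i ∈ Finset.range (S.numImp m), stepDisplacement S A (0 + i) y with hDdef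
  have hD : DifferentiableAt ℝ D (-t₀, h₀) := DifferentiableAt.fun_sum fun i _ =>
    differentiableAt_stepDisplacement (S := S) (0 + (i : ℤ)) hy₀
  set D' := fderiv ℝ D (-t₀, h₀)
  have hD' : HasFDerivAt D D' (-t₀, h₀) := hD.hasFDerivAt
  have hsum := fun τ r (hr : r ∈ A.V) => sum_stepDisplacement hiso hmT 0 (τ := τ) hr
  have hτ : HasDerivAt (fun τ => D (-τ, h₀)) (D' (-1, 0)) t₀ :=
    HasFDerivAt.comp_hasDerivAt (l := D) (f := fun τ => (-τ, h₀)) t₀ hD'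
      ((hasDerivAt_neg t₀).prodMk (hasDerivAt_const t₀ h₀))
  have hr : HasDerivAt (fun r => D (-t₀, r)) (D' (0, 1)) h₀ :=
    HasFDerivAt.comp_hasDerivAt (l := D) (f := fun r => (-t₀, r)) h₀ hD'
      ((hasDerivAt_const h₀ (-t₀)).prodMk (hasDerivAt_id h₀))
  have fst' : ∀ {f : ℝ → ℝ × ℝ} {f' : ℝ × ℝ} {t : ℝ}, HasDerivAt f f' t →
      HasDerivAt (fun t => (f t).1) f'.1 t := fun {f f' t} h =>
    HasFDerivAt.comp_hasDerivAt (l := Prod.fst) (f := f) t hasFDerivAt_fst h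
  have snd' : ∀ {f : ℝ → ℝ × ℝ} {f' : ℝ × ℝ} {t : ℝ}, HasDerivAt f f' t →
      HasDerivAt (fun t => (f t).2) f'.2 t := fun {f f' t} h =>
    HasFDerivAt.comp_hasDerivAt (l := Prod.snd) (f := f) t hasFDerivAt_snd h
  have h1 : deriv (fun τ => melnikovM S A m τ h₀) t₀ = (D' (-1, 0)).2 := by
    simp only [← (hsum _ h₀ hh₀).2]
    exact (snd' hτ).deriv
  have h2 : deriv (fun r => melnikovM S A m t₀ r) h₀ = (D' (0, 1)).2 := by
    refine ((snd' hr).congr_of_eventuallyEq ?_).deriv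
    filter_upwards [A.V_open.mem_nhds hh₀] with r hr' using (hsum t₀ r hr').2.symm
  have h3 : deriv (fun τ => melnikovN S A m τ h₀) t₀ = A.Ω h₀ * (D' (-1, 0)).1 := by
    simp only [← (hsum _ h₀ hh₀).1]
    exact ((fst' hτ).const_mul _).deriv
  have h4 : deriv (fun r => melnikovN S A m t₀ r) h₀ = A.Ω h₀ * (D' (0, 1)).1 := by
    refine (((fst' hr).const_mul (A.Ω h₀)).congr_of_eventuallyEq ?_).deriv
    filter_upwards [A.V_open.mem_nhds hh₀] with r hr'
    have : A.Ω h₀ = A.Ω r := by rw [Ω, Ω, hiso r hr', hiso h₀ hh₀]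
    rw [this]
    exact (hsum t₀ r hr').1.symm
  rw [Matrix.det_fin_two_of, h1, h2, h3, h4] at hJ
  have hlin : ∀ v : ℝ × ℝ, D' v = -v.1 • D' (-1, 0) + v.2 • D' (0, 1) := fun v => by
    rw [← map_smul, ← map_smul, ← map_add]
    simp
  have hinj : Function.Injective (D' : ℝ × ℝ →ₗ[ℝ] ℝ × ℝ) := by
    rw [← LinearMap.ker_eq_bot, LinearMap.ker_eq_bot']
    intro v hv
    have hv' : -v.1 • D' (-1, 0) + v.2 • D' (0, 1) = 0 := (hlin v).symm.trans hv
    have e1 := congrArg Prod.fst hv'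
    have e2 := congrArg Prod.snd hv'
    simp only [Prod.fst_add, Prod.snd_add, Prod.smul_fst, Prod.smul_snd, smul_eq_mul,
      Prod.fst_zero, Prod.snd_zero] at e1 e2
    ext
    · refine (mul_eq_zero.1 (?_ : _ * v.1 = 0)).resolve_left hJ
      linear_combination A.Ω h₀ * ((D' (0, 1)).2 * e1 - (D' (0, 1)).1 * e2)
    · refine (mul_eq_zero.1 (?_ : _ * v.2 = 0)).resolve_left hJ
      linear_combination A.Ω h₀ * ((D' (-1, 0)).2 * e1 - (D' (-1, 0)).1 * e2)
  let B := (LinearEquiv.ofInjectiveEndo (D' : ℝ × ℝ →ₗ[ℝ] ℝ × ℝ) hinj).toContinuousLinearEquiv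
  have hB : (B : ℝ × ℝ →L[ℝ] ℝ × ℝ) = D' := by
    ext <;> rfl
  exact ⟨B, hB ▸ hD'⟩

end ImpulsiveHamiltonianSystem

open ImpulsiveHamiltonianSystem

theorem theorem3p2 (S : ImpulsiveHamiltonianSystem) (A : PeriodicFamily S.H)
    (T₀ : ℝ) (m K : ℕ) (hm : 1 ≤ m) (hK : 1 ≤ K) (hmK : Nat.Coprime m K)
    (hiso : ∀ h ∈ A.V, A.per h = T₀) (hres : T₀ / S.T = (m : ℝ) / K) :
    (∀ C : Set ℝ, IsCompact C → C ⊆ A.V →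
      ∃ ε₀ > 0, ∀ ε : ℝ, 0 < |ε| → |ε| < ε₀ →
        (∃ x : ℝ → ℝ × ℝ, S.IsSubharmonic m ε x ∧
          ∃ τ σ : ℝ, ∃ h ∈ C, x τ = A.q σ h) →
        ∃ t₀ ∈ Icc 0 T₀, ∃ h₀ ∈ C, melnikovM S A m t₀ h₀ = 0 ∧ melnikovN S A m t₀ h₀ = 0) ∧
    (∀ t₀ ∈ Icc 0 T₀, ∀ h₀ ∈ A.V,
      melnikovM S A m t₀ h₀ = 0 → melnikovN S A m t₀ h₀ = 0 →
      Matrix.det !![deriv (fun τ => melnikovM S A m τ h₀) t₀,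
                      deriv (fun r => melnikovM S A m t₀ r) h₀;
                    deriv (fun τ => melnikovN S A m τ h₀) t₀,
                      deriv (fun r => melnikovN S A m t₀ r) h₀] ≠ 0 →
      ∃ ε₀ > 0, ∃ x : ℝ → ℝ → ℝ × ℝ,
        (∀ ε : ℝ, 0 < |ε| → |ε| < ε₀ → S.IsSubharmonic m ε (x ε)) ∧
        ∀ τ : ℝ, Tendsto (fun ε => x ε τ) (𝓝[≠] 0) (𝓝 (A.q (τ - t₀) h₀))) := by
  have hmT := period_eq hK hres
  have hT₀ : 0 < T₀ := by
    have h1 : 0 < (m : ℝ) * S.T := mul_pos (by exact_mod_cast hm) S.T_pos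
    rw [hmT] at h1
    exact (mul_pos_iff_of_pos_left (by exact_mod_cast hK)).1 h1
  have hpunct : ∀ {P : ℝ → Prop}, (∀ᶠ ε in 𝓝[≠] (0 : ℝ), P ε) →
      ∃ ε₀ > 0, ∀ ε : ℝ, 0 < |ε| → |ε| < ε₀ → P ε := by
    intro P hP
    obtain ⟨ε₀, hε₀, h⟩ := Metric.eventually_nhds_iff.1 (eventually_nhdsWithin_iff.1 hP)
    exact ⟨ε₀, hε₀, fun ε h1 h2 => h (by simpa using h2) (abs_pos.1 h1)⟩
  refine ⟨fun C hC hCV =>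
    hpunct (exists_melnikov_zero_of_subharmonic hm hT₀ hiso hmT hC hCV), ?_⟩
  intro t₀ _ h₀ hh₀ hM hN hJ
  obtain ⟨B, hB⟩ := exists_equiv_of_jacobian hiso hmT hh₀ hJ
  have hΩ : A.Ω h₀ ≠ 0 := by
    have := A.per_pos h₀ hh₀
    unfold PeriodicFamily.Ω; positivity
  obtain ⟨h1, h2⟩ := sum_stepDisplacement hiso hmT 0 (τ := t₀) hh₀
  rw [hN, mul_eq_zero] at h1
  obtain ⟨x, hx, hlim⟩ := exists_subharmonic_of_zeros hm hiso hmT ⟨trivial, hh₀⟩ hB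
    (Prod.ext (h1.resolve_left hΩ) (h2.trans hM))
  obtain ⟨ε₀, hε₀, hsub⟩ := hpunct hx
  refine ⟨ε₀, hε₀, x, hsub, fun τ => ?_⟩
  have := hlim τ
  rwa [PeriodicFamily.param, timeShift, ← sub_eq_add_neg] at this

end
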